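/- Fix \(d\ge 2\) and a finite non-empty set \(V\) of agents. A configuration is \(p=(x,\beta)\), consisting of positions \(x_v\in\mathbb R^d\) and clock biases \(\beta_v\in\mathbb R\) for \(v\in V\); it is generic if the \(|V|d\) coordinates of the positions are not a root of any nonzero polynomial with integer coefficients. A GNSS graph is a triple \(\mathcal G=(\Gamma,G_D,G_S)\), where \(\Gamma\) is a loopless directed graph on \(V\) without parallel arcs (both \(uv\) and \(vu\) may occur) and \(G_D=(V,E_D)\), \(G_S=(V,E_S)\) are simple undirected graphs. Its underlying undirected GNSS graph is \(\tilde{\mathcal G}=(\tilde\Gamma,G_D,G_S)\), where \(\tilde\Gamma\) is the multigraph obtained from \(\Gamma\) by forgetting the orientations, so that each edge has multiplicity at most \(2\). Two configurations \(p=(x,\beta)\) and \(p'=(x',\beta')\) are equivalent for \(\mathcal G\) if they have the same pseudoranges \(\|x_u-x_v\|+\beta_v-\beta_u\) for all arcs \(uv\) of \(\Gamma\), the same distances \(\|x_u-x_v\|\) for all \(uv\in E_D\), and the same bias differences \(\beta_v-\beta_u\) for all \(uv\in E_S\); they are congruent if these three quantities agree for all pairs of distinct agents. The framework \((\mathcal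 G,p)\) is rigid if there is \(\varepsilon>0\) such that every \(p'\) with \(\|p-p'\|<\varepsilon\) that is equivalent to \(p\) for \(\mathcal G\) is congruent to \(p\). A simple graph \(G\) on \(V\) is distance rigid in \(\mathbb R^d\) if for every generic \(x\in(\mathbb R^d)^V\) there is \(\varepsilon>0\) such that every \(x'\) with \(\|x-x'\|<\varepsilon\) giving all edges of \(G\) the same lengths as \(x\) satisfies \(\|x'_u-x'_v\|=\|x_u-x_v\|\) for all \(u,v\in V\). Let \(\tilde{\mathcal G}=(\tilde\Gamma,G_D,G_S)\) be an undirected GNSS graph, and let \(E_1\) and \(E_2\) be the sets of edges of multiplicity \(1\) and \(2\) in \(\tilde\Gamma\). A decomposition of \(\tilde{\mathcal G}\) is a pair of simple graphs \(G_D'=(V,E_D\cup E_{PD})\), \(G_S'=(V,E_S\cup E_{PS})\), where \(E_{PD}\cup E_{PS}=E_1\cup E_2\) and \(E_{PD}\cap E_{PS}=E_2\). **Theorem.** Either every generic framework \((\mathcal G,p)\) in \(\mathbb R^d\) whose underlying undirected GNSS graph is \(\tilde{\mathcal G}\) is rigid (in which case \(\tilde{\mathcal G}\) is called rigid in \(\mathbb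 R^d\)), or none of them is. Moreover, \(\tilde{\mathcal G}\) is rigid in \(\mathbb R^d\) if and only if there is a decomposition \((G_D',G_S')\) of \(\tilde{\mathcal G}\) such that \(G_D'\) is distance rigid in \(\mathbb R^d\) and \(G_S'\) is connected. -/

import Mathlib

/-! ### Graphs -/

/-- A simple directed graph of pseudorange measurements: a set of arcs `uv` with `u ≠ v`.
For two vertices `u`, `v` it may contain the arc `uv`, the arc `vu`, both, or none. -/
@[ext]
structure PseudorangeGraph (V : Type*) where
  /-- `Arc u v` says that `uv` is an arc (the pseudorange from `u` to `v` is measured). -/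
  Arc : V → V → Prop
  loopless : ∀ v, ¬ Arc v v

/-- An undirected multigraph without loops in which every edge appears 0 times, once or twice;
`mult e` is the multiplicity of the edge `e`. -/
@[ext]
structure UndirectedPseudorangeGraph (V : Type*) where
  mult : Sym2 V → ℕ
  mult_le_two : ∀ e, mult e ≤ 2
  mult_diag : ∀ v, mult s(v, v) = 0

/-- The arcs of `Γ` whose underlying undirected edge is `e`. -/
def PseudorangeGraph.arcsOver {V : Type*} (Γ : PseudorangeGraph V) (e : Sym2 V) : Set (V × V) :=
  {a | Γ.Arc a.1 a.2 ∧ s(a.1, a.2) = e}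

/-- The underlying undirected multigraph: every arc `uv` contributes one copy of the edge
`{u, v}`. -/
noncomputable def PseudorangeGraph.undirected {V : Type*} (Γ : PseudorangeGraph V) :
    UndirectedPseudorangeGraph V where
  mult e := (Γ.arcsOver e).ncard
  mult_le_two e := by
    induction e using Sym2.ind with
    | _ u v =>
      have hsub : Γ.arcsOver s(u, v) ⊆ {(u, v), (v, u)} := by
        rintro ⟨a, b⟩ ⟨-, hab⟩
        simpa [Sym2.eq_iff] using hab
      exact (Set.ncard_le_ncard hsub (by simp)).trans ((Set.ncard_insert_le _ _).trans (by simp))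
  mult_diag v := by
    have hempty : Γ.arcsOver s(v, v) = ∅ := by
      refine Set.eq_empty_of_forall_notMem ?_
      rintro ⟨a, b⟩ ⟨hab, h⟩
      have h' : a = v ∧ b = v := by simpa [Sym2.eq_iff] using h
      obtain ⟨rfl, rfl⟩ := h'
      exact Γ.loopless _ hab
    simp [hempty]

/-- A GNSS graph: a directed graph of pseudorange constraints, an undirected simple graph of
distance constraints and an undirected simple graph of synchronization constraints, all on the
same vertex set. -/
structure GNSSGraph (V : Type*) where
  /-- the pseudorange arcs -/
  Γ : PseudorangeGraph V
  /-- the distance edges -/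
  GD : SimpleGraph V
  /-- the synchronization edges -/
  GS : SimpleGraph V

/-- An undirected GNSS graph. -/
structure UndirectedGNSSGraph (V : Type*) where
  /-- the undirected pseudorange multigraph -/
  Γ : UndirectedPseudorangeGraph V
  /-- the distance edges -/
  GD : SimpleGraph V
  /-- the synchronization edges -/
  GS : SimpleGraph V

/-- The undirected GNSS graph underlying a GNSS graph. -/
noncomputable def GNSSGraph.undirected {V : Type*} (G : GNSSGraph V) : UndirectedGNSSGraph V where
  Γ := G.Γ.undirected
  GD := G.GD
  GS := G.GS

/-- The complete GNSS graph: every arc between distinct vertices, every distance edge and every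
synchronization edge. -/
def GNSSGraph.complete (V : Type*) : GNSSGraph V where
  Γ := { Arc := fun u v => u ≠ v, loopless := fun _ h => h rfl }
  GD := ⊤
  GS := ⊤

/-! ### Configurations -/

/-- A spatial configuration: the positions `x v ∈ ℝ^d` of the agents. -/
abbrev SpatialConfig (V : Type*) (d : ℕ) : Type _ := V → EuclideanSpace ℝ (Fin d)

/-- A pseudorange configuration `p = (x, β)`: the positions `x v ∈ ℝ^d` and the clock biases
`β v ∈ ℝ` of the agents. -/
abbrev PseudorangeConfig (V : Type*) (d : ℕ) : Type _ := SpatialConfig V d × (V → ℝ)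

/-- The spatial coordinates of the agents are not a root of any nonzero polynomial with integer
coefficients. -/
def SpatialConfig.IsGeneric {V : Type*} {d : ℕ} (x : SpatialConfig V d) : Prop :=
  ∀ P : MvPolynomial (V × Fin d) ℤ, MvPolynomial.aeval (fun i => x i.1 i.2) P = 0 → P = 0

/-- A pseudorange configuration is generic if its spatial coordinates are; nothing is asked of
the clock biases. -/
def PseudorangeConfig.IsGeneric {V : Type*} {d : ℕ} (p : PseudorangeConfig V d) : Prop :=
  SpatialConfig.IsGeneric p.1

/-! ### Distance rigidity -/

/-- The distance frameworks `(G, x)` and `(G, x')` are equivalent: the edges of `G` have the same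
length in both. -/
def DistanceEquivalent {V : Type*} {d : ℕ} (G : SimpleGraph V) (x x' : SpatialConfig V d) : Prop :=
  ∀ u v, G.Adj u v → ‖x u - x v‖ = ‖x' u - x' v‖

/-- The distance framework `(G, x)` is (locally) rigid: the equivalent configurations near `x` are
congruent to it, that is, equivalent for the complete graph. Nearness is in the sup norm of the
coordinates, which is equivalent to the Euclidean norm. -/
def IsDistanceRigidFramework {V : Type*} [Fintype V] {d : ℕ} (G : SimpleGraph V)
    (x : SpatialConfig V d) : Prop :=
  ∃ ε : ℝ, 0 < ε ∧ ∀ x' : SpatialConfig V d, ‖x - x'‖ < ε →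
    DistanceEquivalent G x x' → DistanceEquivalent ⊤ x x'

/-- The graph `G` is distance rigid in `ℝ^d`: its generic frameworks are rigid. -/
def IsDistanceRigid {V : Type*} [Fintype V] (d : ℕ) (G : SimpleGraph V) : Prop :=
  ∀ x : SpatialConfig V d, x.IsGeneric → IsDistanceRigidFramework G x

/-! ### GNSS rigidity -/

/-- The pseudorange from `u` to `v`. -/
noncomputable def PseudorangeConfig.pseudorange {V : Type*} {d : ℕ} (p : PseudorangeConfig V d)
    (u v : V) : ℝ :=
  ‖p.1 u - p.1 v‖ + p.2 v - p.2 u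

/-- The GNSS frameworks `(G, p)` and `(G, p')` are equivalent: pseudoranges along the arcs, lengths
of the distance edges, and bias differences along the synchronization edges are the same. -/
def GNSSGraph.Equivalent {V : Type*} {d : ℕ} (G : GNSSGraph V) (p p' : PseudorangeConfig V d) :
    Prop :=
  (∀ u v, G.Γ.Arc u v →
    PseudorangeConfig.pseudorange p u v = PseudorangeConfig.pseudorange p' u v) ∧
  (∀ u v, G.GD.Adj u v → ‖p.1 u - p.1 v‖ = ‖p'.1 u - p'.1 v‖) ∧
  (∀ u v, G.GS.Adj u v → p.2 v - p.2 u = p'.2 v - p'.2 u)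

/-- The GNSS framework `(G, p)` is (locally) rigid: the equivalent configurations near `p` are
congruent to it, that is, equivalent for the complete GNSS graph. -/
def GNSSGraph.IsRigidFramework {V : Type*} [Fintype V] {d : ℕ} (G : GNSSGraph V)
    (p : PseudorangeConfig V d) : Prop :=
  ∃ ε : ℝ, 0 < ε ∧ ∀ p' : PseudorangeConfig V d, ‖p - p'‖ < ε →
    G.Equivalent p p' → (GNSSGraph.complete V).Equivalent p p'

/-- The undirected GNSS graph `G` is rigid in `ℝ^d`: every generic GNSS framework in `ℝ^d` whose
underlying undirected graph is `G` is rigid. -/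
def UndirectedGNSSGraph.IsRigid {V : Type*} [Fintype V] (d : ℕ) (G : UndirectedGNSSGraph V) :
    Prop :=
  ∀ H : GNSSGraph V, H.undirected = G →
    ∀ p : PseudorangeConfig V d, PseudorangeConfig.IsGeneric p → H.IsRigidFramework p

/-- The undirected GNSS graph `G` is flexible in `ℝ^d`: no generic GNSS framework in `ℝ^d` whose
underlying undirected graph is `G` is rigid. -/
def UndirectedGNSSGraph.IsFlexible {V : Type*} [Fintype V] (d : ℕ) (G : UndirectedGNSSGraph V) :
    Prop :=
  ∀ H : GNSSGraph V, H.undirected = G →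
    ∀ p : PseudorangeConfig V d, PseudorangeConfig.IsGeneric p → ¬ H.IsRigidFramework p

/-! ### Decompositions -/

/-- The simple graphs `GD`, `GS` form a decomposition of the undirected multigraph `Γ`: a single
edge goes to exactly one of them, a double edge to both. -/
def UndirectedPseudorangeGraph.IsDecomposition {V : Type*} (Γ : UndirectedPseudorangeGraph V)
    (GD GS : SimpleGraph V) : Prop :=
  GD.edgeSet ∪ GS.edgeSet = {e | Γ.mult e = 1} ∪ {e | Γ.mult e = 2} ∧
  GD.edgeSet ∩ GS.edgeSet = {e | Γ.mult e = 2}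

/-- The simple graphs `GD'`, `GS'` form a decomposition of the undirected GNSS graph `G`. -/
def UndirectedGNSSGraph.IsDecomposition {V : Type*} (G : UndirectedGNSSGraph V)
    (GD' GS' : SimpleGraph V) : Prop :=
  ∃ GPD GPS : SimpleGraph V, G.Γ.IsDecomposition GPD GPS ∧
    GD'.edgeSet = G.GD.edgeSet ∪ GPD.edgeSet ∧
    GS'.edgeSet = G.GS.edgeSet ∪ GPS.edgeSet

/-! Up to scaling by the length `ℓ` of the edge, the gradient of a pseudorange along `uv` is `D + ℓ
B`, and along `vu` it is `D - ℓ B`, where `D` is the gradient of half the squared distance and `B`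
that of the bias difference. The entries of `D` and `B` are polynomials in the coordinates. The
arithmetic core is that, for `d ≥ 2` and generic positions, no edge length lies in the field
generated by the coordinates and the other edge lengths
(`SpatialConfig.IsGeneric.edgeLength_notMem_closure`). It is used twice.

It shows that an element of the ring generated by coordinates and lengths that vanishes at one
generic configuration vanishes identically (`eq_zero_of_mem_lengthRing`). Hence linear relations
between gradients persist near a generic point, rigidity of a generic framework is equivalent to
infinitesimal rigidity (`GNSSGraph.isRigidFramework_iff`), and the latter does not depend on the
generic point.

It also allows single arcs to be traded for pure measurements. Given a basis of rows `D + ℓ B`,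
multilinearity of the determinant selects from each row one summand so that the result is still a
basis (`LinearIndependent.exists_piecewise`); this reads off a decomposition. Conversely, `D` or `B`
may be replaced by `D ± ℓ B` without losing independence, since `ℓ` is outside the field containing
everything else (`LinearIndependent.piecewise_add_smul`); the sign, that is the orientation, is
irrelevant. A double edge yields both `D + ℓ B` and `D - ℓ B`, hence both `D` and `B`. For pure
measurements positions and clocks decouple: rigidity means a rigid distance graph and a connected
synchronization graph. -/

/-! ### Square roots over a subfield -/

section SquareRoots

variable {F : Type*} [Field F]

/-- Adjoining a square root `a` of an element of `L` yields the elements `u + v * a`. -/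
theorem Subfield.exists_add_mul_of_mem_closure_insert {L : Subfield F} {a : F} (ha : a ^ 2 ∈ L)
    {y : F} (hy : y ∈ Subfield.closure (insert a (L : Set F))) :
    ∃ u ∈ L, ∃ v ∈ L, y = u + v * a := by
  by_cases haL : a ∈ L
  · have : Subfield.closure (insert a (L : Set F)) ≤ L :=
      Subfield.closure_le.2 (Set.insert_subset haL subset_rfl)
    exact ⟨y, this hy, 0, L.zero_mem, by simp⟩
  induction hy using Subfield.closure_induction with
  | mem x hx =>
    rcases hx with rfl | hx
    · exact ⟨0, L.zero_mem, 1, L.one_mem, by simp⟩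
    · exact ⟨x, hx, 0, L.zero_mem, by simp⟩
  | one => exact ⟨1, L.one_mem, 0, L.zero_mem, by simp⟩
  | add x y _ _ hx hy =>
    obtain ⟨u, hu, v, hv, rfl⟩ := hx
    obtain ⟨u', hu', v', hv', rfl⟩ := hy
    exact ⟨u + u', L.add_mem hu hu', v + v', L.add_mem hv hv', by ring⟩
  | neg x _ hx =>
    obtain ⟨u, hu, v, hv, rfl⟩ := hx
    exact ⟨-u, L.neg_mem hu, -v, L.neg_mem hv, by ring⟩
  | inv x _ hx =>
    obtain ⟨u, hu, v, hv, rfl⟩ := hx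
    -- The inverse is obtained with the conjugate `u - v * a`. For `v ≠ 0` the norm is nonzero, as a
    -- vanishing factor would put `a` into `L`.
    have hN : u ^ 2 - v ^ 2 * a ^ 2 ∈ L :=
      L.sub_mem (pow_mem hu 2) (L.mul_mem (pow_mem hv 2) ha)
    refine ⟨u / (u ^ 2 - v ^ 2 * a ^ 2), L.div_mem hu hN,
      -v / (u ^ 2 - v ^ 2 * a ^ 2), L.div_mem (L.neg_mem hv) hN, ?_⟩
    by_cases hv0 : v = 0
    · subst hv0
      by_cases hu0 : u = 0
      · simp [hu0]
      · have : u ^ 2 - 0 ^ 2 * a ^ 2 = u * u := by ring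
        rw [this, div_mul_cancel_left₀ hu0]
        simp
    have h1 : u + v * a ≠ 0 := by
      intro h
      refine haL ?_
      have : a = -u / v := by field_simp; linear_combination h
      rw [this]
      exact L.div_mem (L.neg_mem hu) hv
    have h2 : u - v * a ≠ 0 := by
      intro h
      refine haL ?_
      have : a = u / v := by field_simp; linear_combination -h
      rw [this]
      exact L.div_mem hu hv
    have h3 : u ^ 2 - v ^ 2 * a ^ 2 ≠ 0 := by
      have : u ^ 2 - v ^ 2 * a ^ 2 = (u + v * a) * (u - v * a) := by ring
      rw [this]
      exact mul_ne_zero h1 h2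
    field_simp
    ring
  | mul x y _ _ hx hy =>
    obtain ⟨u, hu, v, hv, rfl⟩ := hx
    obtain ⟨u', hu', v', hv', rfl⟩ := hy
    exact ⟨u * u' + v * v' * a ^ 2,
      L.add_mem (L.mul_mem hu hu') (L.mul_mem (L.mul_mem hv hv') ha), u * v' + v * u',
      L.add_mem (L.mul_mem hu hv') (L.mul_mem hv hu'), by ring⟩

/-- A square root that lies in a field generated over `K` by square roots becomes an element of `K`
after multiplication with some of these. -/
theorem Subfield.exists_mul_prod_mem_of_mem_closure [NeZero (2 : F)] {ι : Type*} (K : Subfield F)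
    (l : ι → F) (s : Finset ι) (hl : ∀ i ∈ s, l i ^ 2 ∈ K) (hl0 : ∀ i ∈ s, l i ≠ 0) (y : F)
    (hy : y ^ 2 ∈ K) (hmem : y ∈ Subfield.closure ((K : Set F) ∪ l '' s)) :
    ∃ T ⊆ s, y * ∏ i ∈ T, l i ∈ K := by
  classical
  induction s using Finset.induction_on generalizing y with
  | empty =>
    refine ⟨∅, subset_rfl, ?_⟩
    simpa [Subfield.closure_eq] using hmem
  | insert i s his ih =>
    have ih := ih (fun j hj => hl j (Finset.mem_insert_of_mem hj))
      (fun j hj => hl0 j (Finset.mem_insert_of_mem hj))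
    set L := Subfield.closure ((K : Set F) ∪ l '' s) with hL
    have hKL : ∀ x ∈ K, x ∈ L := fun x hx => Subfield.subset_closure (Or.inl hx)
    have hi := hl i (Finset.mem_insert_self i s)
    have hi0 := hl0 i (Finset.mem_insert_self i s)
    have hy' : y ∈ Subfield.closure (insert (l i) (L : Set F)) := by
      refine Subfield.closure_le.2 ?_ hmem
      rintro x (hx | ⟨j, hj, rfl⟩)
      · exact Subfield.subset_closure (Or.inr (hKL x hx))
      · rcases Finset.mem_insert.1 hj with rfl | hj
        · exact Subfield.subset_closure (Or.inl rfl)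
        · exact Subfield.subset_closure
            (Or.inr (Subfield.subset_closure (Or.inr ⟨j, hj, rfl⟩)))
    have key : ∀ z, z ^ 2 ∈ K → z ∈ L → ∃ T ⊆ s, z * ∏ j ∈ T, l j ∈ K := ih
    have step : y ∈ L → ∃ T ⊆ insert i s, y * ∏ j ∈ T, l j ∈ K := fun h => by
      obtain ⟨T, hT, h⟩ := key y hy h
      exact ⟨T, hT.trans (Finset.subset_insert _ _), h⟩
    -- Since the square of `u + v * l i` is in `K`, its cross term forces `l i ∈ L` as soon as `u`
    -- and `v` are both nonzero. If `u = 0`, multiplying by `l i` lands in `L`, and `i` joins the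
    -- set `T`.
    obtain ⟨u, hu, v, hv, rfl⟩ := Subfield.exists_add_mul_of_mem_closure_insert (hKL _ hi) hy'
    by_cases hv0 : v = 0
    · exact step (by simpa [hv0] using hu)
    by_cases hu0 : u = 0
    · subst hu0
      obtain ⟨T, hT, h⟩ := key ((0 + v * l i) * l i)
        (by rw [mul_pow]; exact K.mul_mem hy hi)
        (by
          have : (0 + v * l i) * l i = v * l i ^ 2 := by ring
          rw [this]
          exact L.mul_mem hv (hKL _ hi))
      refine ⟨insert i T, Finset.insert_subset_insert _ hT, ?_⟩
      rw [Finset.prod_insert (fun h => his (hT h)), ← mul_assoc]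
      exact h
    · refine step (L.add_mem hu (L.mul_mem hv ?_))
      have h2 : (2 : F) ≠ 0 := two_ne_zero
      have : l i = ((u + v * l i) ^ 2 - u ^ 2 - v ^ 2 * l i ^ 2) / (2 * u * v) := by
        field_simp
        ring
      rw [this]
      have h2L : (2 : F) ∈ L := ofNat_mem L 2
      exact L.div_mem (L.sub_mem (L.sub_mem (hKL _ hy) (pow_mem hu 2))
        (L.mul_mem (pow_mem hv 2) (hKL _ hi))) (L.mul_mem (L.mul_mem h2L hu) hv)

end SquareRoots

/-! ### Edge lengths -/

/-- The length of an edge. -/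
noncomputable def edgeLength {V : Type*} {d : ℕ} (x : SpatialConfig V d) : Sym2 V → ℝ :=
  Sym2.lift ⟨fun u v => ‖x u - x v‖, fun u v => norm_sub_rev (x u) (x v)⟩

@[simp]
theorem edgeLength_mk {V : Type*} {d : ℕ} (x : SpatialConfig V d) (u v : V) :
    edgeLength x s(u, v) = ‖x u - x v‖ := rfl

/-- The squared length of an edge as a polynomial in the coordinates. -/
noncomputable def sqLengthPoly {V : Type*} (d : ℕ) : Sym2 V → MvPolynomial (V × Fin d) ℤ :=
  Sym2.lift ⟨fun u v => ∑ j, (MvPolynomial.X (u, j) - MvPolynomial.X (v, j)) ^ 2, fun u v => by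
    refine Finset.sum_congr rfl fun j _ => ?_
    ring⟩

theorem sqLengthPoly_mk {V : Type*} (d : ℕ) (u v : V) :
    sqLengthPoly d s(u, v) = ∑ j, (MvPolynomial.X (u, j) - MvPolynomial.X (v, j)) ^ 2 := rfl

theorem aeval_sqLengthPoly {V : Type*} {d : ℕ} (x : SpatialConfig V d) (e : Sym2 V) :
    MvPolynomial.aeval (fun i : V × Fin d => x i.1 i.2) (sqLengthPoly d e) = edgeLength x e ^ 2 := by
  induction e using Sym2.ind with
  | _ u v => simp [sqLengthPoly_mk, EuclideanSpace.norm_sq_eq]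

theorem SpatialConfig.IsGeneric.coord_ne {V : Type*} {d : ℕ} {x : SpatialConfig V d}
    (hx : x.IsGeneric) {u v : V} (huv : u ≠ v) (j : Fin d) : x u j ≠ x v j := by
  intro h
  have h0 := hx (MvPolynomial.X (u, j) - MvPolynomial.X (v, j)) (by simp [h])
  have h1 : (u, j) = (v, j) := MvPolynomial.X_injective (sub_eq_zero.1 h0)
  exact huv (Prod.ext_iff.1 h1).1

theorem SpatialConfig.IsGeneric.injective {V : Type*} {d : ℕ} (hd : 0 < d) {x : SpatialConfig V d}
    (hx : x.IsGeneric) : Function.Injective x := by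
  intro u v h
  by_contra huv
  exact hx.coord_ne huv ⟨0, hd⟩ (by rw [h])

theorem edgeLength_ne_zero {V : Type*} {d : ℕ} {x : SpatialConfig V d}
    (hx : Function.Injective x) {e : Sym2 V} (he : ¬ e.IsDiag) : edgeLength x e ≠ 0 := by
  induction e using Sym2.ind with
  | _ u v => simpa [sub_eq_zero] using hx.ne he

theorem edgeLength_of_isDiag {V : Type*} {d : ℕ} (x : SpatialConfig V d) {e : Sym2 V}
    (he : e.IsDiag) : edgeLength x e = 0 := by
  induction e using Sym2.ind with
  | _ u v =>
    obtain rfl : u = v := he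
    simp

open Polynomial in
/-- No product of squared edge lengths over a nonempty set of edges is a square in the field of
rational functions. -/
theorem sq_mul_prod_sqLengthPoly_ne_sq {V : Type*} {d : ℕ} (hd : 2 ≤ d) {x : SpatialConfig V d}
    (hx : x.IsGeneric) {S : Finset (Sym2 V)} (hS : S.Nonempty) (hdiag : ∀ e ∈ S, ¬ e.IsDiag)
    {a b : MvPolynomial (V × Fin d) ℤ} (ha : a ≠ 0) :
    a ^ 2 * ∏ e ∈ S, sqLengthPoly d e ≠ b ^ 2 := by
  classical
  intro hab
  obtain ⟨e₀, he₀⟩ := hS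
  induction e₀ using Sym2.ind with
  | _ u v =>
  have huv : u ≠ v := hdiag _ he₀
  set j₀ : Fin d := ⟨0, by omega⟩
  set j₁ : Fin d := ⟨1, by omega⟩
  have hj : j₁ ≠ j₀ := by simp [j₀, j₁, Fin.ext_iff]
  -- specialize all coordinates but one to those of `x`
  let φ : MvPolynomial (V × Fin d) ℤ →ₐ[ℤ] ℂ[X] := MvPolynomial.aeval
    (fun i => if i = (u, j₀) then X else C ((x i.1 i.2 : ℝ) : ℂ))
  have hφX : φ (MvPolynomial.X (u, j₀)) = X := by simp [φ]
  have hφC : ∀ i, i ≠ (u, j₀) → φ (MvPolynomial.X i) = C ((x i.1 i.2 : ℝ) : ℂ) := fun i hi => by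
    simp [φ, hi]
  have hφeval : ∀ P, (φ P).eval ((x u j₀ : ℝ) : ℂ) =
      ((MvPolynomial.aeval (fun i : V × Fin d => x i.1 i.2) P : ℝ) : ℂ) := by
    intro P
    induction P using MvPolynomial.induction_on with
    | C n => simp [φ]
    | add p q hp hq => simp [hp, hq]
    | mul_X p i hp =>
      rw [map_mul, map_mul, eval_mul, hp]
      by_cases hi : i = (u, j₀)
      · subst hi; rw [hφX]; simp
      · rw [hφC i hi]; simp
  -- Evaluating the remaining variable at its value in `x` recovers the full evaluation at `x`,
  -- which kills no nonzero polynomial.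
  have hφ0 : ∀ P, P ≠ 0 → φ P ≠ 0 := by
    intro P hP h
    refine hP (hx P ?_)
    have := hφeval P
    rw [h, eval_zero] at this
    exact_mod_cast this.symm
  let c : V → ℝ := fun w => ∑ j ∈ Finset.univ.erase j₀, (x u j - x w j) ^ 2
  have hφq : ∀ w, w ≠ u →
      φ (sqLengthPoly d s(u, w)) = (X - C ((x w j₀ : ℝ) : ℂ)) ^ 2 + C ((c w : ℝ) : ℂ) := by
    intro w hw
    rw [sqLengthPoly_mk, map_sum, ← Finset.add_sum_erase _ _ (Finset.mem_univ j₀)]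
    congr 1
    · rw [map_pow, map_sub, hφX, hφC _ (by simp [hw])]
    · simp only [c, Complex.ofReal_sum, map_sum]
      refine Finset.sum_congr rfl fun j hjm => ?_
      have hj' : j ≠ j₀ := Finset.ne_of_mem_erase hjm
      rw [map_pow, map_sub, hφC _ (by simp [hj']), hφC _ (by simp [hw])]
      simp
  have hφq' : ∀ e : Sym2 V, u ∉ e → φ (sqLengthPoly d e) = C (((edgeLength x e) ^ 2 : ℝ) : ℂ) := by
    intro e he
    induction e using Sym2.ind with
    | _ w w' =>
      simp only [Sym2.mem_iff, not_or] at he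
      rw [sqLengthPoly_mk, edgeLength_mk, EuclideanSpace.norm_sq_eq, map_sum, Complex.ofReal_sum,
        map_sum]
      refine Finset.sum_congr rfl fun j _ => ?_
      rw [map_pow, map_sub, hφC _ (by simp [Ne.symm he.1]), hφC _ (by simp [Ne.symm he.2])]
      simp
  -- Here `d ≥ 2` matters: the second coordinate makes the constant term positive, so the quadratic
  -- has two distinct nonreal roots `z` and `z'`. In dimension one it would be a square.
  have hcv : 0 < c v := by
    refine Finset.sum_pos' (fun j _ => sq_nonneg _) ⟨j₁, by simp [hj], ?_⟩
    have := hx.coord_ne huv j₁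
    positivity [sub_ne_zero.2 this]
  set r : ℝ := Real.sqrt (c v)
  have hr : 0 < r := Real.sqrt_pos.2 hcv
  have hr2 : r ^ 2 = c v := Real.sq_sqrt hcv.le
  set z : ℂ := ⟨x v j₀, r⟩ with hz
  set z' : ℂ := ⟨x v j₀, -r⟩ with hz'
  have hfac : φ (sqLengthPoly d s(u, v)) = (X - C z) * (X - C z') := by
    rw [hφq v huv.symm]
    have h1 : z + z' = 2 * ((x v j₀ : ℝ) : ℂ) := by
      apply Complex.ext <;> simp [hz, hz']; ring
    have h2 : z * z' = ((x v j₀ : ℝ) : ℂ) ^ 2 + ((c v : ℝ) : ℂ) := by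
      rw [← hr2]
      apply Complex.ext <;> simp [hz, hz', sq]
      ring
    have h1' := congrArg (C : ℂ → ℂ[X]) h1
    have h2' := congrArg (C : ℂ → ℂ[X]) h2
    simp only [map_add, map_mul, map_pow, map_ofNat] at h1' h2'
    linear_combination X * h1' - h2'
  -- For an edge `uw` the imaginary part at `z` is `2 * (x v j₀ - x w j₀) * r`; an edge avoiding `u`
  -- gives a nonzero constant.
  have hother : ∀ e ∈ S.erase s(u, v), (φ (sqLengthPoly d e)).eval z ≠ 0 := by
    intro e he
    have hne := Finset.ne_of_mem_erase he
    have hd' := hdiag e (Finset.mem_of_mem_erase he)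
    by_cases hu : u ∈ e
    · obtain ⟨w, rfl⟩ := hu
      have hw : w ≠ u := fun h => hd' (by simp [h])
      have hwv : v ≠ w := fun h => hne (by rw [h])
      rw [hφq w hw]
      intro h
      have him := congrArg Complex.im h
      simp [hz, sq] at him
      have : (x v j₀ - x w j₀) * r = 0 := by linarith
      rcases mul_eq_zero.1 this with h | h
      · exact hx.coord_ne hwv j₀ (sub_eq_zero.1 h)
      · exact hr.ne' h
    · rw [hφq' e hu, eval_C]
      have := edgeLength_ne_zero (hx.injective (by omega)) hd'
      exact_mod_cast pow_ne_zero 2 this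
  have hab' := congrArg φ hab
  rw [← Finset.mul_prod_erase _ _ he₀] at hab'
  simp only [map_mul, map_pow, map_prod, hfac] at hab'
  set R := (X - C z') * ∏ e ∈ S.erase s(u, v), φ (sqLengthPoly d e) with hR
  have hRz : R.eval z ≠ 0 := by
    rw [hR, eval_mul, eval_prod]
    refine mul_ne_zero ?_ (Finset.prod_ne_zero_iff.2 hother)
    rw [eval_sub, eval_X, eval_C]
    intro h
    have := congrArg Complex.im h
    simp [hz, hz'] at this
    linarith
  have hR0 : R ≠ 0 := fun h => hRz (by rw [h, eval_zero])
  have hAB : φ a ^ 2 * ((X - C z) * R) = φ b ^ 2 := by rw [← hab', hR]; ring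
  have hA0 : φ a ^ 2 ≠ 0 := pow_ne_zero 2 (hφ0 a ha)
  have hX0 : (X - C z) ≠ 0 := X_sub_C_ne_zero z
  -- The multiplicity of the root `z` is odd on the left, because `X - C z` occurs once besides a
  -- square, and even on the right.
  have hm := congrArg (rootMultiplicity z) hAB
  have hB0 : φ b ^ 2 ≠ 0 := by
    rw [← hAB]
    exact mul_ne_zero hA0 (mul_ne_zero hX0 hR0)
  rw [rootMultiplicity_mul (by rw [hAB]; exact hB0),
    rootMultiplicity_mul (mul_ne_zero hX0 hR0), rootMultiplicity_X_sub_C_self,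
    rootMultiplicity_eq_zero hRz, ← count_roots, ← count_roots, roots_pow, roots_pow,
    Multiset.count_nsmul, Multiset.count_nsmul] at hm
  omega

/-- The length of an edge in a generic configuration does not lie in the field generated by the
coordinates and the lengths of the other edges. -/
theorem SpatialConfig.IsGeneric.edgeLength_notMem_closure {V : Type*} [Finite V] {d : ℕ}
    (hd : 2 ≤ d) {x : SpatialConfig V d} (hx : x.IsGeneric) {e : Sym2 V} (he : ¬ e.IsDiag) :
    edgeLength x e ∉ Subfield.closure
      (Set.range (fun i : V × Fin d => x i.1 i.2) ∪ edgeLength x '' {e' | e' ≠ e}) := by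
  classical
  have := Fintype.ofFinite V
  intro hmem
  set coords : V × Fin d → ℝ := fun i => x i.1 i.2 with hcoords
  set K : Subfield ℝ := Subfield.closure (Set.range coords) with hK
  have hsub : ∀ P : MvPolynomial (V × Fin d) ℤ, MvPolynomial.aeval coords P ∈ K := by
    intro P
    induction P using MvPolynomial.induction_on with
    | C n => simp
    | add p q hp hq => rw [map_add]; exact K.add_mem hp hq
    | mul_X p i hp =>
      rw [map_mul, MvPolynomial.aeval_X]
      exact K.mul_mem hp (Subfield.subset_closure ⟨i, rfl⟩)
  have hsq : ∀ e', edgeLength x e' ^ 2 ∈ K := fun e' => by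
    rw [← aeval_sqLengthPoly]; exact hsub _
  have hinj := hx.injective (by omega : 0 < d)
  -- Diagonal pairs have length zero; they are dropped because the square-root lemma needs nonzero
  -- generators.
  set s : Finset (Sym2 V) := Finset.univ.filter fun e' => e' ≠ e ∧ ¬ e'.IsDiag with hs
  obtain ⟨T, hT, hTK⟩ := Subfield.exists_mul_prod_mem_of_mem_closure K (edgeLength x) s
    (fun e' _ => hsq e') (fun e' h => edgeLength_ne_zero hinj (by simp [hs] at h; exact h.2))
    (edgeLength x e) (hsq e) (by
      refine Subfield.closure_le.2 ?_ hmem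
      rintro y (hy | ⟨e', he', rfl⟩)
      · exact Subfield.subset_closure (Or.inl (Subfield.subset_closure hy))
      · by_cases hdg : e'.IsDiag
        · rw [edgeLength_of_isDiag x hdg]; exact Subfield.zero_mem _
        · exact Subfield.subset_closure (Or.inr ⟨e', by simp [hs, hdg]; exact he', rfl⟩))
  have heT : e ∉ T := fun h => by simpa [hs] using hT h
  rw [← Finset.prod_insert heT, hK, Subfield.mem_closure_iff] at hTK
  have hpoly : ∀ y ∈ Subring.closure (Set.range coords),
      ∃ P : MvPolynomial (V × Fin d) ℤ, MvPolynomial.aeval coords P = y := by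
    intro y hy
    have : Subring.closure (Set.range coords) ≤
        (MvPolynomial.aeval coords : MvPolynomial (V × Fin d) ℤ →ₐ[ℤ] ℝ).toRingHom.range := by
      refine Subring.closure_le.2 ?_
      rintro _ ⟨i, rfl⟩
      exact ⟨MvPolynomial.X i, MvPolynomial.aeval_X coords i⟩
    exact this hy
  obtain ⟨_, hb, _, ha, heq⟩ := hTK
  obtain ⟨b, rfl⟩ := hpoly _ hb
  obtain ⟨a, rfl⟩ := hpoly _ ha
  have hprod : ∏ i ∈ insert e T, edgeLength x i ≠ 0 := by
    refine Finset.prod_ne_zero_iff.2 fun i hi => edgeLength_ne_zero hinj ?_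
    rcases Finset.mem_insert.1 hi with rfl | hi
    · exact he
    · have := hT hi; simp [hs] at this; exact this.2
  have ha0 : MvPolynomial.aeval coords a ≠ 0 := fun h => by
    rw [h, div_zero] at heq; exact hprod heq.symm
  -- The product of the lengths over `insert e T` equals `b / a` at `x`. Squaring gives a relation
  -- between polynomials at `x`, which genericity turns into the forbidden identity.
  refine sq_mul_prod_sqLengthPoly_ne_sq hd hx (S := insert e T) (Finset.insert_nonempty _ _) ?_
    (a := a) (b := b) (fun h => ha0 (by rw [h, map_zero])) ?_
  · intro i hi
    rcases Finset.mem_insert.1 hi with rfl | hi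
    · exact he
    · have := hT hi; simp [hs] at this; exact this.2
  · refine sub_eq_zero.1 (hx _ ?_)
    simp only [map_sub, map_mul, map_pow, map_prod, aeval_sqLengthPoly]
    rw [Finset.prod_pow, ← heq]
    rw [div_pow, mul_div_cancel₀ _ (pow_ne_zero 2 ha0), sub_self]

/-! ### Functions generated by coordinates and edge lengths -/

/-- The ring version of the statement for subfields. It is needed because functions on
configurations form a ring with zero divisors. -/
theorem Subring.exists_add_mul_of_mem_closure_insert {R : Type*} [CommRing R] {A : Subring R}
    {a : R} (ha : a ^ 2 ∈ A) {y : R} (hy : y ∈ Subring.closure (insert a (A : Set R))) :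
    ∃ u ∈ A, ∃ v ∈ A, y = u + v * a := by
  induction hy using Subring.closure_induction with
  | mem x hx =>
    rcases hx with rfl | hx
    · exact ⟨0, A.zero_mem, 1, A.one_mem, by simp⟩
    · exact ⟨x, hx, 0, A.zero_mem, by simp⟩
  | zero => exact ⟨0, A.zero_mem, 0, A.zero_mem, by simp⟩
  | one => exact ⟨1, A.one_mem, 0, A.zero_mem, by simp⟩
  | add x y _ _ hx hy =>
    obtain ⟨u, hu, v, hv, rfl⟩ := hx
    obtain ⟨u', hu', v', hv', rfl⟩ := hy
    exact ⟨u + u', A.add_mem hu hu', v + v', A.add_mem hv hv', by ring⟩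
  | neg x _ hx =>
    obtain ⟨u, hu, v, hv, rfl⟩ := hx
    exact ⟨-u, A.neg_mem hu, -v, A.neg_mem hv, by ring⟩
  | mul x y _ _ hx hy =>
    obtain ⟨u, hu, v, hv, rfl⟩ := hx
    obtain ⟨u', hu', v', hv', rfl⟩ := hy
    exact ⟨u * u' + v * v' * a ^ 2,
      A.add_mem (A.mul_mem hu hu') (A.mul_mem (A.mul_mem hv hv') ha), u * v' + v * u',
      A.add_mem (A.mul_mem hu hv') (A.mul_mem hv hu'), by ring⟩

/-- The ring of functions on the spatial configurations that is generated by the coordinates and by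
the lengths of the edges in `s`. -/
noncomputable def lengthRing {V : Type*} (d : ℕ) (s : Set (Sym2 V)) :
    Subring (SpatialConfig V d → ℝ) :=
  Subring.closure (Set.range (fun (i : V × Fin d) (x : SpatialConfig V d) => x i.1 i.2) ∪
    (fun e x => edgeLength x e) '' s)

section LengthRing

variable {V : Type*} {d : ℕ}

theorem coord_mem_lengthRing (s : Set (Sym2 V)) (v : V) (j : Fin d) :
    (fun x : SpatialConfig V d => x v j) ∈ lengthRing d s :=
  Subring.subset_closure (Or.inl ⟨(v, j), rfl⟩)

theorem edgeLength_mem_lengthRing {s : Set (Sym2 V)} {e : Sym2 V} (he : e ∈ s) :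
    (fun x : SpatialConfig V d => edgeLength x e) ∈ lengthRing d s :=
  Subring.subset_closure (Or.inr ⟨e, he, rfl⟩)

theorem edgeLength_sq_mem_lengthRing (s : Set (Sym2 V)) (e : Sym2 V) :
    (fun x : SpatialConfig V d => edgeLength x e) ^ 2 ∈ lengthRing d s := by
  induction e using Sym2.ind with
  | _ u v =>
    have : (fun x : SpatialConfig V d => edgeLength x s(u, v)) ^ 2 =
        ∑ j, ((fun x : SpatialConfig V d => x u j) - fun x => x v j) ^ 2 := by
      funext x
      simp [EuclideanSpace.norm_sq_eq]
    rw [this]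
    exact sum_mem fun j _ =>
      pow_mem (sub_mem (coord_mem_lengthRing s u j) (coord_mem_lengthRing s v j)) 2

/-- The field generated by the coordinates of `x` and by its edge lengths other than that of `e`. -/
noncomputable def lengthField (x : SpatialConfig V d) (e : Sym2 V) : Subfield ℝ :=
  Subfield.closure
    (Set.range (fun i : V × Fin d => x i.1 i.2) ∪ edgeLength x '' {e' | e' ≠ e})

theorem apply_mem_lengthField {s : Set (Sym2 V)} {f : SpatialConfig V d → ℝ}
    (hf : f ∈ lengthRing d s) (x : SpatialConfig V d) {e : Sym2 V} (he : e ∉ s) :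
    f x ∈ lengthField x e := by
  have : lengthRing d s ≤ (lengthField x e).toSubring.comap (Pi.evalRingHom _ x) := by
    refine Subring.closure_le.2 ?_
    rintro _ (⟨i, rfl⟩ | ⟨e', he', rfl⟩)
    · exact Subfield.subset_closure (Or.inl ⟨i, rfl⟩)
    · exact Subfield.subset_closure (Or.inr ⟨e', fun h => he (h ▸ he'), rfl⟩)
  exact this hf

/-- A function generated by coordinates and edge lengths that vanishes at one generic
configuration vanishes everywhere. -/
theorem eq_zero_of_mem_lengthRing [Finite V] (hd : 2 ≤ d) {x : SpatialConfig V d}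
    (hx : x.IsGeneric) {s : Set (Sym2 V)} {f : SpatialConfig V d → ℝ}
    (hf : f ∈ lengthRing d s) (hfx : f x = 0) : f = 0 := by
  induction s, s.toFinite using Set.Finite.induction_on generalizing f with
  | empty =>
    -- Without lengths the function is an integer polynomial in the coordinates, and genericity
    -- applies directly.
    have : lengthRing d (∅ : Set (Sym2 V)) ≤ (RingHom.pi fun y : SpatialConfig V d =>
        (MvPolynomial.aeval (fun i : V × Fin d => y i.1 i.2) :
          MvPolynomial (V × Fin d) ℤ →ₐ[ℤ] ℝ).toRingHom).range := by
      refine Subring.closure_le.2 ?_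
      rintro _ (⟨i, rfl⟩ | ⟨e', he', rfl⟩)
      · exact ⟨MvPolynomial.X i, funext fun y => MvPolynomial.aeval_X _ _⟩
      · exact he'.elim
    obtain ⟨P, rfl⟩ := this hf
    rw [hx P hfx, map_zero]
  | @insert e s hes _ ih =>
    have hf' : f ∈ Subring.closure
        (insert (fun x : SpatialConfig V d => edgeLength x e) (lengthRing d s : Set _)) := by
      refine Subring.closure_le.2 ?_ hf
      rintro _ (⟨i, rfl⟩ | ⟨e', rfl | he', rfl⟩)
      · exact Subring.subset_closure (Or.inr (coord_mem_lengthRing s _ _))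
      · exact Subring.subset_closure (Or.inl rfl)
      · exact Subring.subset_closure (Or.inr (edgeLength_mem_lengthRing he'))
    -- Write the function as `g + h * ℓ` with `ℓ` the length of `e`. If `h x ≠ 0`, then `ℓ = -g x /
    -- h x` contradicts the independence of lengths, so `g x = h x = 0` and induction applies to
    -- both.
    obtain ⟨g, hg, h, hh, rfl⟩ :=
      Subring.exists_add_mul_of_mem_closure_insert (edgeLength_sq_mem_lengthRing s e) hf'
    by_cases he : e.IsDiag
    · have h0 : (fun x : SpatialConfig V d => edgeLength x e) = 0 :=
        funext fun y => edgeLength_of_isDiag y he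
      rw [h0, mul_zero, add_zero] at hfx ⊢
      exact ih hg hfx
    have hfx' : g x + h x * edgeLength x e = 0 := hfx
    have hhx : h x = 0 := by
      by_contra hne
      refine hx.edgeLength_notMem_closure hd he ?_
      have : edgeLength x e = -g x / h x := by
        field_simp
        linear_combination hfx'
      rw [this]
      exact div_mem (neg_mem (apply_mem_lengthField hg x hes)) (apply_mem_lengthField hh x hes)
    have hgx : g x = 0 := by simpa [hhx] using hfx'
    rw [ih hg hgx, ih hh hhx, zero_mul, zero_add]

end LengthRing

/-! ### Matrices over a ring of functions -/

section Gram

open scoped Matrix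

theorem Subring.det_mem {X R n : Type*} [CommRing R] [Fintype n] [DecidableEq n]
    (A : Subring (X → R)) {M : X → Matrix n n R} (hM : ∀ i j, (fun x => M x i j) ∈ A) :
    (fun x => (M x).det) ∈ A := by
  have : (fun x => (M x).det) =
      ∑ σ : Equiv.Perm n, Equiv.Perm.sign σ • ∏ i, fun x => M x (σ i) i := by
    funext x
    simp [Matrix.det_apply]
  rw [this]
  refine sum_mem fun σ _ => ?_
  rw [Units.smul_def]
  exact zsmul_mem (prod_mem fun i _ => hM _ _) _

theorem Subring.adjugate_mem {X R n : Type*} [CommRing R] [Fintype n] [DecidableEq n]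
    (A : Subring (X → R)) {M : X → Matrix n n R} (hM : ∀ i j, (fun x => M x i j) ∈ A) (i j : n) :
    (fun x => (M x).adjugate i j) ∈ A := by
  simp only [Matrix.adjugate_apply]
  refine A.det_mem fun k l => ?_
  by_cases hk : k = j
  · subst hk
    simp only [Matrix.updateRow_self]
    by_cases hl : l = i
    · subst hl; simp only [Pi.single_eq_same]; exact A.one_mem
    · simp only [Pi.single_eq_of_ne hl]; exact A.zero_mem
  · simp only [Matrix.updateRow_ne hk]
    exact hM k l

theorem Subring.dotProduct_mem {X R n : Type*} [CommRing R] [Fintype n]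
    (A : Subring (X → R)) {v w : X → n → R} (hv : ∀ i, (fun x => v x i) ∈ A)
    (hw : ∀ i, (fun x => w x i) ∈ A) : (fun x => v x ⬝ᵥ w x) ∈ A := by
  have : (fun x => v x ⬝ᵥ w x) = ∑ i, (fun x => v x i) * fun x => w x i := by
    funext x
    simp [dotProduct]
  rw [this]
  exact sum_mem fun i _ => A.mul_mem (hv i) (hw i)

/-- If `v` annihilates the Gram matrix, then `v ᵥ* A` has squared norm zero. Independence of rows
thus becomes the nonvanishing of one polynomial in the entries. -/
theorem Matrix.det_mul_transpose_ne_zero_iff {ι κ : Type*} [Fintype ι] [DecidableEq ι] [Fintype κ]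
    (A : Matrix ι κ ℝ) : (A * A.transpose).det ≠ 0 ↔ LinearIndependent ℝ A.row := by
  rw [← Matrix.vecMul_injective_iff, ← isUnit_iff_ne_zero, ← Matrix.isUnit_iff_isUnit_det,
    ← Matrix.vecMul_injective_iff_isUnit]
  constructor
  · intro h v w hvw
    refine h ?_
    simp only [← Matrix.vecMul_vecMul]
    exact congrArg (· ᵥ* A.transpose) hvw
  · intro h
    have hker : ∀ v, v ᵥ* (A * A.transpose) = 0 → v = 0 := by
      intro v hv
      have h0 : (v ᵥ* A) ⬝ᵥ (v ᵥ* A) = 0 := by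
        have := congrArg (· ⬝ᵥ v) hv
        simp only [zero_dotProduct] at this
        rw [← Matrix.vecMul_vecMul, ← Matrix.dotProduct_mulVec, Matrix.mulVec_transpose] at this
        exact this
      refine h ?_
      simpa using dotProduct_self_eq_zero.1 h0
    intro v w hvw
    refine sub_eq_zero.1 (hker _ ?_)
    rw [Matrix.sub_vecMul]
    exact sub_eq_zero.2 hvw

/-- Cramer's rule for the coefficients of a vector in the span of the rows of `A`. -/
theorem Matrix.mem_span_row_iff {ι κ : Type*} [Fintype ι] [DecidableEq ι] [Fintype κ]
    (A : Matrix ι κ ℝ) (hA : LinearIndependent ℝ A.row) (e : κ → ℝ) :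
    e ∈ Submodule.span ℝ (Set.range A.row) ↔
      ((A *ᵥ e) ᵥ* (A * A.transpose).adjugate) ᵥ* A = (A * A.transpose).det • e := by
  constructor
  · intro h
    obtain ⟨c, rfl⟩ := (Submodule.mem_span_range_iff_exists_fun ℝ).1 h
    have hc : ∑ i, c i • A.row i = c ᵥ* A := by
      funext k
      simp [Matrix.vecMul, dotProduct]
    -- The adjugate recovers `c` up to the Gram determinant. No division occurs, so for rows over a
    -- ring of functions the criterion is an identity in that ring.
    have hAc : A *ᵥ (c ᵥ* A) = c ᵥ* (A * Aᵀ) := by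
      rw [← Matrix.vecMul_transpose, Matrix.vecMul_vecMul]
    rw [hc, hAc, Matrix.vecMul_vecMul c (A * Aᵀ), Matrix.mul_adjugate, Matrix.vecMul_smul,
      Matrix.vecMul_one, Matrix.smul_vecMul]
  · intro h
    have hdet := (A.det_mul_transpose_ne_zero_iff).2 hA
    refine (Submodule.smul_mem_iff _ hdet).1 ?_
    rw [← h, Submodule.mem_span_range_iff_exists_fun]
    refine ⟨(A *ᵥ e) ᵥ* (A * A.transpose).adjugate, ?_⟩
    funext k
    simp [Matrix.vecMul, dotProduct]

end Gram

/-! ### Rows with entries in the ring of coordinates and lengths -/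

section Rows

open scoped Matrix

variable {V : Type*} [Finite V] {d : ℕ} {κ ι : Type*} [Fintype κ] [Finite ι]
  {z : SpatialConfig V d → ι → κ → ℝ} {w : SpatialConfig V d → κ → ℝ}

/-- A Gram determinant that vanishes at the generic `y` vanishes identically, hence also at `x`,
which may be arbitrary. -/
theorem linearIndependent_of_isGeneric (hd : 2 ≤ d)
    (hz : ∀ i k, (fun x => z x i k) ∈ lengthRing d (Set.univ : Set (Sym2 V)))
    {x y : SpatialConfig V d} (hy : y.IsGeneric) (hind : LinearIndependent ℝ (z x)) :
    LinearIndependent ℝ (z y) := by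
  classical
  have := Fintype.ofFinite ι
  have hmem : (fun x => (Matrix.of (z x) * (Matrix.of (z x)).transpose).det) ∈
      lengthRing d (Set.univ : Set (Sym2 V)) :=
    Subring.det_mem _ fun i j => Subring.dotProduct_mem _ (hz i) (hz j)
  by_contra h
  refine (Matrix.det_mul_transpose_ne_zero_iff (Matrix.of (z x))).2 hind ?_
  refine congrFun (eq_zero_of_mem_lengthRing hd hy hmem ?_) x
  by_contra h0
  exact h ((Matrix.det_mul_transpose_ne_zero_iff (Matrix.of (z y))).1 h0)

/-- By Cramer's rule membership is the vanishing of functions in `lengthRing`, which spreads from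
the generic `x` to all configurations. Only independence is asked at `y`, so the lemma also covers
the nongeneric points near `x`. -/
theorem mem_span_of_mem_span_isGeneric (hd : 2 ≤ d)
    (hz : ∀ i k, (fun x => z x i k) ∈ lengthRing d (Set.univ : Set (Sym2 V)))
    (hw : ∀ k, (fun x => w x k) ∈ lengthRing d (Set.univ : Set (Sym2 V)))
    {x y : SpatialConfig V d} (hx : x.IsGeneric) (hindx : LinearIndependent ℝ (z x))
    (hindy : LinearIndependent ℝ (z y)) (hmem : w x ∈ Submodule.span ℝ (Set.range (z x))) :
    w y ∈ Submodule.span ℝ (Set.range (z y)) := by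
  classical
  have := Fintype.ofFinite ι
  set A : SpatialConfig V d → Matrix ι κ ℝ := fun x => Matrix.of (z x) with hA
  have hgram : ∀ i j, (fun x => (A x * (A x).transpose) i j) ∈
      lengthRing d (Set.univ : Set (Sym2 V)) := fun i j => Subring.dotProduct_mem _ (hz i) (hz j)
  refine (Matrix.mem_span_row_iff (A y) hindy (w y)).2 (funext fun k => sub_eq_zero.1 ?_)
  have hx' := congrFun ((Matrix.mem_span_row_iff (A x) hindx (w x)).1 hmem) k
  refine congrFun (eq_zero_of_mem_lengthRing hd hx (s := Set.univ) (f := fun x =>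
    (((A x *ᵥ w x) ᵥ* (A x * (A x).transpose).adjugate) ᵥ* A x) k -
      ((A x * (A x).transpose).det • w x) k) (sub_mem ?_ ?_) (sub_eq_zero.2 hx')) y
  · refine Subring.dotProduct_mem _ (fun i => ?_) (fun i => hz i k)
    exact Subring.dotProduct_mem _ (fun j => Subring.dotProduct_mem _ (hz j) hw)
      (fun j => Subring.adjugate_mem _ hgram j i)
  · exact mul_mem (Subring.det_mem _ hgram) (hw k)

end Rows

/-! ### Functions on the fibres of a submersion -/

section Fibres

open Filter Topology

variable {E : Type*} [NormedAddCommGroup E] [NormedSpace ℝ E]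

/-- A nonzero functional vanishing on a proper range would be a linear relation between the `φ i`.
-/
theorem ContinuousLinearMap.range_pi_eq_top {ι : Type*} [Fintype ι] {φ : ι → E →L[ℝ] ℝ}
    (hφ : LinearIndependent ℝ φ) : (ContinuousLinearMap.pi φ).range = ⊤ := by
  classical
  by_contra hne
  obtain ⟨c, hc0, hc⟩ := Submodule.exists_le_ker_of_lt_top _ (lt_top_iff_ne_top.2 hne)
  refine hc0 ?_
  have hsum : ∑ i, c (Pi.single i 1) • φ i = 0 := by
    ext h
    have := hc ⟨h, rfl⟩
    rw [LinearMap.mem_ker, LinearMap.pi_apply_eq_sum_univ] at this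
    have hs : ∀ i, (Pi.single i 1 : ι → ℝ) = fun j => if i = j then 1 else 0 := fun i =>
      funext fun j => by simp [Pi.single_apply, eq_comm]
    simpa [mul_comm, hs] using this
  have h0 := Fintype.linearIndependent_iff.1 hφ _ hsum
  refine LinearMap.pi_ext' fun i => LinearMap.ext_ring ?_
  simpa using h0 i

variable [CompleteSpace E]

/-- A function whose derivative is, near `p`, a combination of the derivatives of the components of
a submersion is locally constant on the fibre of the submersion through `p`. -/
theorem eventually_eq_of_fderiv_mem_span {ι : Type*} [Finite ι] {f : ι → E → ℝ} {g : E → ℝ}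
    {p : E} (hf : ∀ i, ContDiffAt ℝ 1 (f i) p) (hg : ContDiffAt ℝ 1 g p)
    (hind : LinearIndependent ℝ fun i => fderiv ℝ (f i) p)
    (hspan : ∀ᶠ q in 𝓝 p,
      fderiv ℝ g q ∈ Submodule.span ℝ (Set.range fun i => fderiv ℝ (f i) q)) :
    ∀ᶠ q in 𝓝 p, (∀ i, f i q = f i p) → g q = g p := by
  have := Fintype.ofFinite ι
  set F : E → ι → ℝ := fun q i => f i q
  have hFp : ContDiffAt ℝ 1 F p := contDiffAt_pi.2 hf
  have hF' : HasStrictFDerivAt F (ContinuousLinearMap.pi fun i => fderiv ℝ (f i) p) p :=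
    hasStrictFDerivAt_pi.2 fun i => (hf i).hasStrictFDerivAt (by simp)
  -- The implicit function theorem parametrizes the fibre through `p` by the kernel of the
  -- derivative; `g` is then shown to be constant along this parametrization.
  let φ := hF'.implicitFunctionDataOfComplemented F _ (ContinuousLinearMap.range_pi_eq_top hind)
    (ContinuousLinearMap.ker_closedComplemented_of_finiteDimensional_range _)
  have hright : ContDiffAt ℝ 1 φ.rightFun p := by
    change ContDiffAt ℝ 1 (fun x => (Classical.choose
      (ContinuousLinearMap.ker_closedComplemented_of_finiteDimensional_range _)) (x - p)) p
    fun_prop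
  have hψ : ContDiffAt ℝ 1 φ.implicitFunction.uncurry (φ.prodFun p) :=
    ImplicitFunctionData.contDiffAt_implicitFunction (φ := φ) hFp hright one_ne_zero
  have hψp : φ.implicitFunction.uncurry (φ.prodFun p) = p :=
    φ.implicitFunction_apply_image.self_of_nhds
  set y₀ := φ.rightFun p with hy₀
  have hgood : ∀ᶠ q in 𝓝 p, (∀ i, DifferentiableAt ℝ (f i) q) ∧ DifferentiableAt ℝ g q ∧
      fderiv ℝ g q ∈ Submodule.span ℝ (Set.range fun i => fderiv ℝ (f i) q) := by
    refine (eventually_all.2 fun i => ?_).and (Filter.Eventually.and ?_ hspan)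
    · exact ((hf i).eventually (by simp)).mono fun q hq => hq.differentiableAt one_ne_zero
    · exact (hg.eventually (by simp)).mono fun q hq => hq.differentiableAt one_ne_zero
  have hcont : Tendsto φ.implicitFunction.uncurry (𝓝 (φ.prodFun p)) (𝓝 p) := by
    have := hψ.continuousAt.tendsto
    rwa [hψp] at this
  have hdiff : ∀ᶠ z in 𝓝 (φ.prodFun p), DifferentiableAt ℝ φ.implicitFunction.uncurry z :=
    (hψ.eventually (by simp)).mono fun q hq => hq.differentiableAt one_ne_zero
  have hall := ((hcont.eventually hgood).and hdiff).and
    (eventually_eventually_nhds.2 φ.leftFun_implicitFunction)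
  have hincl : ∀ y : (ContinuousLinearMap.pi fun i => fderiv ℝ (f i) p).ker,
      Tendsto (fun y => (F p, y)) (𝓝 y) (𝓝 (F p, y)) := fun y =>
    Continuous.tendsto (by fun_prop) y
  have hall' := (hincl y₀).eventually hall
  obtain ⟨r, hr, hball⟩ := Metric.eventually_nhds_iff_ball.1 hall'
  set ψ := fun y : (ContinuousLinearMap.pi fun i => fderiv ℝ (f i) p).ker => φ.implicitFunction (F p) y with hψdef
  have hderiv : ∀ y ∈ Metric.ball y₀ r, HasFDerivAt (fun y => g (ψ y)) (0 : _ →L[ℝ] ℝ) y := by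
    intro y hy
    obtain ⟨⟨⟨hfd, hgd, hsp⟩, hd⟩, hev⟩ := hball y hy
    have hd' : DifferentiableAt ℝ ψ y :=
      DifferentiableAt.comp y (f := fun y => ((F p, y) : (ι → ℝ) × _))
        (g := φ.implicitFunction.uncurry) hd (by fun_prop)
    have hev' := (hincl y).eventually hev
    -- Each `f i` is constant along `ψ`, so its derivative kills the image of `fderiv ℝ ψ y`; so
    -- does any combination, in particular the derivative of `g`.
    have hfz : ∀ i, (fderiv ℝ (f i) (ψ y)).comp (fderiv ℝ ψ y) = 0 := by
      intro i
      have h1 : HasFDerivAt (fun y => f i (ψ y)) ((fderiv ℝ (f i) (ψ y)).comp (fderiv ℝ ψ y)) y :=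
        HasFDerivAt.comp y (hfd i).hasFDerivAt hd'.hasFDerivAt
      have h2 : HasFDerivAt (fun y => f i (ψ y)) (0 : _ →L[ℝ] ℝ) y := by
        refine (hasFDerivAt_const (f i p) y).congr_of_eventuallyEq ?_
        filter_upwards [hev'] with z hz
        exact congrFun hz i
      exact h1.unique h2
    have h3 : HasFDerivAt (fun y => g (ψ y)) ((fderiv ℝ g (ψ y)).comp (fderiv ℝ ψ y)) y :=
      HasFDerivAt.comp y hgd.hasFDerivAt hd'.hasFDerivAt
    obtain ⟨c, hc⟩ := (Submodule.mem_span_range_iff_exists_fun ℝ).1 hsp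
    have h4 : (fderiv ℝ g (ψ y)).comp (fderiv ℝ ψ y) = 0 := by
      have hc' : fderiv ℝ g (ψ y) = ∑ i, c i • fderiv ℝ (f i) (ψ y) := hc.symm
      rw [hc']
      ext v
      have : ∀ i, fderiv ℝ (f i) (ψ y) (fderiv ℝ ψ y v) = 0 := fun i =>
        congrArg (fun L => L v) (hfz i)
      change (∑ i, c i • fderiv ℝ (f i) (ψ y)) (fderiv ℝ ψ y v) = 0
      rw [_root_.sum_apply]
      refine Finset.sum_eq_zero fun i _ => ?_
      rw [_root_.smul_apply, this, smul_zero]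
    rwa [h4] at h3
  have hconst : ∀ y ∈ Metric.ball y₀ r, g (ψ y) = g (ψ y₀) := fun y hy =>
    (Metric.isOpen_ball).is_const_of_fderiv_eq_zero (convex_ball y₀ r).isPreconnected
      (fun z hz => (hderiv z hz).differentiableAt.differentiableWithinAt)
      (fun z hz => (hderiv z hz).fderiv) hy (Metric.mem_ball_self hr)
  have hψ₀ : ψ y₀ = p := hψp
  filter_upwards [φ.implicitFunction_apply_image,
    hright.continuousAt.eventually (Metric.ball_mem_nhds y₀ hr)] with q hq hqb hfq
  have hFq : F q = F p := funext hfq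
  have h := hconst _ hqb
  rw [hψ₀] at h
  have hq' : ψ (φ.rightFun q) = q := by
    rw [hψdef, ← hFq]
    exact hq
  rwa [hq'] at h

/-- Suppose that near `p` linear relations between the derivatives of the functions `g k` at `p`
persist. Then near `p` the values of the `g j` with `j ∈ J` determine those of all `g k` if and only
if the derivatives of the `g j` span those of all `g k`. -/
theorem eventually_forall_eq_iff_fderiv_mem_span {κ : Type*} [Finite κ] {g : κ → E → ℝ} {p : E}
    (hg : ∀ k, ContDiffAt ℝ 1 (g k) p)
    (hrank : ∀ I : Set κ, LinearIndepOn ℝ (fun k => fderiv ℝ (g k) p) I → ∀ k,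
      fderiv ℝ (g k) p ∈ Submodule.span ℝ ((fun k => fderiv ℝ (g k) p) '' I) →
      ∀ᶠ q in 𝓝 p, fderiv ℝ (g k) q ∈ Submodule.span ℝ ((fun k => fderiv ℝ (g k) q) '' I))
    (J : Set κ) :
    (∀ᶠ q in 𝓝 p, (∀ j ∈ J, g j q = g j p) → ∀ k, g k q = g k p) ↔
      ∀ k, fderiv ℝ (g k) p ∈ Submodule.span ℝ ((fun k => fderiv ℝ (g k) p) '' J) := by
  have := Fintype.ofFinite κ
  -- Passing to a basis of the derivatives makes the selected functions a submersion at `p`; the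
  -- other functions of `J` are constant on its fibre.
  obtain ⟨I, hIJ, hJI, hI⟩ : ∃ I ⊆ J, (fun k => fderiv ℝ (g k) p) '' J ⊆
      Submodule.span ℝ ((fun k => fderiv ℝ (g k) p) '' I) ∧
      LinearIndepOn ℝ (fun k => fderiv ℝ (g k) p) I := by
    obtain ⟨I, hIJ, -, hJI, hI⟩ := exists_linearIndepOn_extension
      (linearIndepOn_empty ℝ (fun k => fderiv ℝ (g k) p)) (Set.empty_subset J)
    exact ⟨I, hIJ, hJI, hI⟩
  have hspanIJ : Submodule.span ℝ ((fun k => fderiv ℝ (g k) p) '' J) =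
      Submodule.span ℝ ((fun k => fderiv ℝ (g k) p) '' I) :=
    le_antisymm (Submodule.span_le.2 hJI) (Submodule.span_mono (Set.image_mono hIJ))
  rw [hspanIJ]
  have hfibre : ∀ k, fderiv ℝ (g k) p ∈ Submodule.span ℝ ((fun k => fderiv ℝ (g k) p) '' I) →
      ∀ᶠ q in 𝓝 p, (∀ i ∈ I, g i q = g i p) → g k q = g k p := by
    intro k hk
    have := eventually_eq_of_fderiv_mem_span (f := fun i : I => g i) (fun i => hg i) (hg k) hI
      ((hrank I hI k hk).mono fun q hq => by rwa [Set.image_eq_range] at hq)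
    exact this.mono fun q hq h => hq fun i => h i i.2
  constructor
  · intro hrigid k
    have hJ : ∀ᶠ q in 𝓝 p, ∀ j, j ∈ J → (∀ i ∈ I, g i q = g i p) → g j q = g j p :=
      eventually_all.2 fun j => by
        by_cases hj : j ∈ J
        · exact (hfibre j (hJI ⟨j, hj, rfl⟩)).mono fun q hq _ => hq
        · exact Eventually.of_forall fun q hj' => (hj hj').elim
    -- A function that is locally constant on the fibre has an extremum there, so Lagrange
    -- multipliers apply. Independence of the constraints makes the multiplier of `g k` nonzero.
    have hextr : IsLocalExtrOn (g k) {q | ∀ i : I, g i q = g i p} p := by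
      refine Or.inl ?_
      refine eventually_nhdsWithin_iff.2 ?_
      filter_upwards [hJ, hrigid] with q hq hr hmem
      exact (hr (fun j hj => hq j hj fun i hi => hmem ⟨i, hi⟩) k).ge
    have := Fintype.ofFinite I
    obtain ⟨Λ, Λ₀, hne, hsum⟩ := hextr.exists_multipliers_of_hasStrictFDerivAt
      (f := fun i : I => g i) (fun i => (hg i).hasStrictFDerivAt (by simp))
      ((hg k).hasStrictFDerivAt (by simp))
    have hΛ₀ : Λ₀ ≠ 0 := by
      rintro rfl
      rw [zero_smul, add_zero] at hsum
      exact hne (Prod.ext (funext (Fintype.linearIndependent_iff.1 hI Λ hsum)) rfl)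
    refine (Submodule.smul_mem_iff _ hΛ₀).1 ?_
    rw [eq_neg_of_add_eq_zero_right hsum]
    exact Submodule.neg_mem _ (Submodule.sum_mem _ fun i _ =>
      Submodule.smul_mem _ _ (Submodule.subset_span ⟨i, i.2, rfl⟩))
  · intro h
    filter_upwards [eventually_all.2 fun k => hfibre k (h k)] with q hq hJ k
    exact hq k fun i hi => hJ i (hIJ hi)

end Fibres

/-! ### Measurements and their gradients -/

/-- A measurement between two agents `u`, `v`: the sum of a distance, if the first Boolean is set,
and of a bias difference, if the second one is set. -/
abbrev Measurement (V : Type*) : Type _ := (Bool × Bool) × V × V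

/-- The index set of the coordinates of a pseudorange configuration. -/
abbrev ConfigCoord (V : Type*) (d : ℕ) : Type _ := V × Fin d ⊕ V

namespace Measurement

variable {V : Type*} {d : ℕ}

/-- The coefficient of the distance. -/
def distCoeff (m : Measurement V) : ℝ := if m.1.1 then 1 else 0

/-- The coefficient of the bias difference. -/
def biasCoeff (m : Measurement V) : ℝ := if m.1.2 then 1 else 0

/-- The measured value. -/
noncomputable def value (m : Measurement V) (p : PseudorangeConfig V d) : ℝ :=
  m.distCoeff * ‖p.1 m.2.1 - p.1 m.2.2‖ + m.biasCoeff * (p.2 m.2.2 - p.2 m.2.1)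

end Measurement

open Classical in
/-- Half the gradient of the squared distance between `u` and `v`. -/
noncomputable def distRow {V : Type*} {d : ℕ} (x : SpatialConfig V d) (u v : V) :
    ConfigCoord V d → ℝ :=
  Sum.elim
    (fun i => ((if i.1 = u then 1 else 0) - (if i.1 = v then 1 else 0)) * (x u i.2 - x v i.2))
    (fun _ => 0)

open Classical in
/-- The gradient of the bias difference between `u` and `v`. -/
noncomputable def biasRow {V : Type*} (d : ℕ) (u v : V) : ConfigCoord V d → ℝ :=
  Sum.elim (fun _ => 0) (fun w => (if w = v then 1 else 0) - (if w = u then 1 else 0))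

/-- The gradient of the measurement, multiplied by the distance of the two agents. -/
noncomputable def Measurement.row {V : Type*} {d : ℕ} (m : Measurement V) (x : SpatialConfig V d) :
    ConfigCoord V d → ℝ :=
  m.distCoeff • distRow x m.2.1 m.2.2 +
    (m.biasCoeff * ‖x m.2.1 - x m.2.2‖) • biasRow d m.2.1 m.2.2

section Rows

variable {V : Type*} {d : ℕ}

theorem distRow_swap (x : SpatialConfig V d) (u v : V) : distRow x v u = distRow x u v := by
  funext c
  rcases c with i | w
  · simp only [distRow, Sum.elim_inl]; ring
  · rfl

theorem biasRow_swap (u v : V) : biasRow d v u = -biasRow d u v := by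
  funext c
  rcases c with i | w
  · simp [biasRow]
  · simp [biasRow]

@[simp]
theorem distRow_self (x : SpatialConfig V d) (u : V) : distRow x u u = 0 := by
  funext c
  rcases c with i | w <;> simp [distRow]

@[simp]
theorem biasRow_self (u : V) : biasRow d u u = 0 := by
  funext c
  rcases c with i | w <;> simp [biasRow]

theorem distRow_mem_lengthRing (u v : V) (c : ConfigCoord V d) (s : Set (Sym2 V)) :
    (fun x => distRow x u v c) ∈ lengthRing d s := by
  have hind : ∀ (P : Prop) (_ : Decidable P),
      (fun _ : SpatialConfig V d => (if P then 1 else 0 : ℝ)) ∈ lengthRing d s := by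
    intro P _
    split_ifs
    · exact one_mem _
    · exact zero_mem _
  rcases c with i | w
  · exact mul_mem (sub_mem (hind _ _) (hind _ _))
      (sub_mem (coord_mem_lengthRing _ _ _) (coord_mem_lengthRing _ _ _))
  · exact zero_mem _

theorem biasRow_mem_lengthRing (u v : V) (c : ConfigCoord V d) (s : Set (Sym2 V)) :
    (fun _ => biasRow d u v c) ∈ lengthRing d s := by
  have hind : ∀ (P : Prop) (_ : Decidable P),
      (fun _ : SpatialConfig V d => (if P then 1 else 0 : ℝ)) ∈ lengthRing d s := by
    intro P _
    split_ifs
    · exact one_mem _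
    · exact zero_mem _
  rcases c with i | w
  · exact zero_mem _
  · exact sub_mem (hind _ _) (hind _ _)

/-- This is the purpose of scaling the gradient by the distance: the denominator of the unit vector
disappears. -/
theorem Measurement.row_mem_lengthRing (m : Measurement V) (c : ConfigCoord V d) :
    (fun x => m.row x c) ∈ lengthRing d (Set.univ : Set (Sym2 V)) := by
  obtain ⟨⟨a, b⟩, u, v⟩ := m
  have hind : ∀ t : Bool,
      (fun _ : SpatialConfig V d => (if t then 1 else 0 : ℝ)) ∈
        lengthRing d (Set.univ : Set (Sym2 V)) := by
    intro t
    split_ifs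
    · exact one_mem _
    · exact zero_mem _
  exact add_mem (mul_mem (hind a) (distRow_mem_lengthRing u v c _))
    (mul_mem (mul_mem (hind b) (edgeLength_mem_lengthRing (e := s(u, v)) (Set.mem_univ _)))
      (biasRow_mem_lengthRing u v c _))

theorem Measurement.row_eq_smul {x : SpatialConfig V d} (hx : Function.Injective x)
    (m : Measurement V) :
    m.row x = ‖x m.2.1 - x m.2.2‖ • (‖x m.2.1 - x m.2.2‖⁻¹ • m.row x) := by
  obtain ⟨⟨a, b⟩, u, v⟩ := m
  by_cases huv : u = v
  · subst huv; simp [Measurement.row]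
  · rw [smul_inv_smul₀]
    exact norm_ne_zero_iff.2 (sub_ne_zero.2 (hx.ne huv))

end Rows

/-! ### Derivatives of measurements -/

section Derivatives

open Filter Topology

variable {V : Type*} [Fintype V] {d : ℕ}

/-- The coordinate functionals on pseudorange configurations. -/
noncomputable def coordFunctional :
    ConfigCoord V d → PseudorangeConfig V d →L[ℝ] ℝ :=
  Sum.elim
    (fun i => (EuclideanSpace.proj i.2).comp
      ((ContinuousLinearMap.proj i.1).comp (ContinuousLinearMap.fst ℝ _ _)))
    (fun v => (ContinuousLinearMap.proj v).comp (ContinuousLinearMap.snd ℝ _ _))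

/-- The functional with the given coefficients. -/
noncomputable def functionalOfCoeffs :
    (ConfigCoord V d → ℝ) →ₗ[ℝ] (PseudorangeConfig V d →L[ℝ] ℝ) :=
  Fintype.linearCombination ℝ coordFunctional

theorem functionalOfCoeffs_apply (w : ConfigCoord V d → ℝ) (h : PseudorangeConfig V d) :
    functionalOfCoeffs w h =
      ∑ v, ∑ j, w (Sum.inl (v, j)) * h.1 v j + ∑ v, w (Sum.inr v) * h.2 v := by
  rw [functionalOfCoeffs, Fintype.linearCombination_apply, _root_.sum_apply, Fintype.sum_sum_type,
    Fintype.sum_prod_type]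
  rfl

theorem functionalOfCoeffs_injective :
    Function.Injective (functionalOfCoeffs (V := V) (d := d)) := by
  classical
  rw [injective_iff_map_eq_zero]
  intro w hw
  funext c
  rcases c with ⟨v, j⟩ | v
  · have := congrArg (fun L => L (Pi.single v (EuclideanSpace.single j 1), 0)) hw
    simpa [functionalOfCoeffs_apply, Pi.single_apply, Finset.sum_ite_eq, apply_ite,
      ite_apply] using this
  · have := congrArg (fun L => L (0, Pi.single v 1)) hw
    simpa [functionalOfCoeffs_apply, Pi.single_apply] using this

theorem functionalOfCoeffs_distRow (x : SpatialConfig V d) (u v : V) (h : PseudorangeConfig V d) :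
    functionalOfCoeffs (distRow x u v) h = inner ℝ (x u - x v) (h.1 u - h.1 v) := by
  classical
  rw [functionalOfCoeffs_apply]
  simp only [distRow, Sum.elim_inl, Sum.elim_inr, zero_mul, Finset.sum_const_zero, add_zero]
  rw [Finset.sum_comm, PiLp.inner_apply]
  refine Finset.sum_congr rfl fun j _ => ?_
  simp only [sub_mul, ite_mul, one_mul, zero_mul, Finset.sum_sub_distrib, Finset.sum_ite_eq',
    Finset.mem_univ, if_true]
  simp
  ring

theorem functionalOfCoeffs_biasRow (u v : V) (h : PseudorangeConfig V d) :
    functionalOfCoeffs (biasRow d u v) h = h.2 v - h.2 u := by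
  classical
  rw [functionalOfCoeffs_apply]
  simp [biasRow, sub_mul, Finset.sum_sub_distrib]

theorem Measurement.contDiffAt_value {m : Measurement V} {p : PseudorangeConfig V d}
    (hp : Function.Injective p.1) : ContDiffAt ℝ 1 (m.value (d := d)) p := by
  obtain ⟨⟨a, b⟩, u, v⟩ := m
  have h2 : ContDiffAt ℝ 1 (fun p : PseudorangeConfig V d => p.2 v - p.2 u) p := by fun_prop
  have h1 : ContDiffAt ℝ 1 (fun p : PseudorangeConfig V d => ‖p.1 u - p.1 v‖) p := by
    by_cases huv : u = v
    · subst huv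
      simpa using contDiffAt_const
    · refine ContDiffAt.norm ℝ (by fun_prop) ?_
      exact sub_ne_zero.2 (hp.ne huv)
  exact (contDiffAt_const.mul h1).add (contDiffAt_const.mul h2)

theorem Measurement.fderiv_value (m : Measurement V) {p : PseudorangeConfig V d}
    (hp : Function.Injective p.1) :
    fderiv ℝ (m.value (d := d)) p =
      functionalOfCoeffs (‖p.1 m.2.1 - p.1 m.2.2‖⁻¹ • m.row p.1) := by
  obtain ⟨⟨a, b⟩, u, v⟩ := m
  -- Degenerate measurements with `u = v` are admitted; their value and their row are zero, so the
  -- convention `0⁻¹ = 0` does no harm.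
  by_cases huv : u = v
  · subst huv
    have : Measurement.value (d := d) ((a, b), u, u) = fun _ => 0 := by
      funext q
      simp [Measurement.value]
    simp [this]
  have hne : ‖p.1 u - p.1 v‖ ≠ 0 := norm_ne_zero_iff.2 (sub_ne_zero.2 (hp.ne huv))
  let Lx (w : V) : PseudorangeConfig V d →L[ℝ] EuclideanSpace ℝ (Fin d) :=
    (ContinuousLinearMap.proj w).comp (ContinuousLinearMap.fst ℝ _ _)
  let Lb (w : V) : PseudorangeConfig V d →L[ℝ] ℝ :=
    (ContinuousLinearMap.proj w).comp (ContinuousLinearMap.snd ℝ _ _)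
  have hL : HasFDerivAt (fun p : PseudorangeConfig V d => p.1 u - p.1 v) (Lx u - Lx v) p :=
    (Lx u - Lx v).hasFDerivAt
  have h1 := hL.norm_sq.sqrt (by positivity)
  simp only [Real.sqrt_sq (norm_nonneg _)] at h1
  have h2 : HasFDerivAt (fun p : PseudorangeConfig V d => p.2 v - p.2 u) (Lb v - Lb u) p :=
    (Lb v - Lb u).hasFDerivAt
  have h3 := (h1.const_mul (Measurement.distCoeff ((a, b), u, v))).add
    (h2.const_mul (Measurement.biasCoeff ((a, b), u, v)))
  have h4 : HasFDerivAt (Measurement.value (d := d) ((a, b), u, v)) _ p := h3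
  rw [h4.fderiv]
  refine ContinuousLinearMap.ext fun h => ?_
  simp only [Measurement.row, map_add, map_smul, _root_.add_apply, _root_.smul_apply,
    functionalOfCoeffs_distRow, functionalOfCoeffs_biasRow, smul_eq_mul]
  simp [Lx, Lb]
  field_simp
  simp only [inner_sub_left, inner_sub_right]

/-- The measurements made in a GNSS graph. -/
def GNSSGraph.measurements {V : Type*} (H : GNSSGraph V) : Set (Measurement V) :=
  {m | (m.1 = (true, true) ∧ H.Γ.Arc m.2.1 m.2.2) ∨ (m.1 = (true, false) ∧ H.GD.Adj m.2.1 m.2.2) ∨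
    (m.1 = (false, true) ∧ H.GS.Adj m.2.1 m.2.2)}

theorem GNSSGraph.equivalent_iff {V : Type*} (H : GNSSGraph V) (p q : PseudorangeConfig V d) :
    H.Equivalent p q ↔ ∀ m ∈ H.measurements, m.value q = m.value p := by
  constructor
  · rintro ⟨h1, h2, h3⟩ ⟨⟨a, b⟩, u, v⟩ (⟨hab, h⟩ | ⟨hab, h⟩ | ⟨hab, h⟩) <;>
      obtain ⟨rfl, rfl⟩ := Prod.ext_iff.1 hab
    · have := h1 u v h
      simp only [PseudorangeConfig.pseudorange] at this
      simp [Measurement.value, Measurement.distCoeff, Measurement.biasCoeff]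
      linarith
    · have := h2 u v h
      simp [Measurement.value, Measurement.distCoeff, Measurement.biasCoeff, this]
    · have := h3 u v h
      simp [Measurement.value, Measurement.distCoeff, Measurement.biasCoeff, this]
  · intro h
    refine ⟨fun u v huv => ?_, fun u v huv => ?_, fun u v huv => ?_⟩
    · have := h ((true, true), u, v) (Or.inl ⟨rfl, huv⟩)
      simp [Measurement.value, Measurement.distCoeff, Measurement.biasCoeff] at this
      simp only [PseudorangeConfig.pseudorange]
      linarith
    · have := h ((true, false), u, v) (Or.inr (Or.inl ⟨rfl, huv⟩))
      simp [Measurement.value, Measurement.distCoeff, Measurement.biasCoeff] at this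
      exact this.symm
    · have := h ((false, true), u, v) (Or.inr (Or.inr ⟨rfl, huv⟩))
      simp [Measurement.value, Measurement.distCoeff, Measurement.biasCoeff] at this
      exact this.symm

/-- The additional measurements, those with `u = v` or with both Booleans unset, are identically
zero. Congruence can therefore be tested on the whole finite type. -/
theorem GNSSGraph.complete_equivalent_iff {V : Type*} (p q : PseudorangeConfig V d) :
    (GNSSGraph.complete V).Equivalent p q ↔ ∀ m : Measurement V, m.value q = m.value p := by
  refine ⟨fun h => ?_, fun h => (GNSSGraph.equivalent_iff _ p q).2 fun m _ => h m⟩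
  rintro ⟨⟨a, b⟩, u, v⟩
  by_cases huv : u = v
  · subst huv; simp [Measurement.value]
  · have h2 := h.2.1 u v huv
    have h3 := h.2.2 u v huv
    simp only [Measurement.value]
    rw [h2, h3]

/-- The span of the gradients of the measurements in `M`. -/
noncomputable def rowSpan (M : Set (Measurement V)) (x : SpatialConfig V d) :
    Submodule ℝ (ConfigCoord V d → ℝ) :=
  Submodule.span ℝ ((fun m => m.row x) '' M)

/-- Gradients and rows differ by nonzero factors, except for `u = v`, where both vanish. -/
theorem fderiv_value_mem_span_iff {p : PseudorangeConfig V d} (hp : Function.Injective p.1)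
    (M : Set (Measurement V)) (k : Measurement V) :
    fderiv ℝ (k.value (d := d)) p ∈
        Submodule.span ℝ ((fun m : Measurement V => fderiv ℝ (m.value (d := d)) p) '' M) ↔
      k.row p.1 ∈ rowSpan M p.1 := by
  set n : Measurement V → ConfigCoord V d → ℝ :=
    fun m => ‖p.1 m.2.1 - p.1 m.2.2‖⁻¹ • m.row p.1 with hn
  have h1 : (fun m : Measurement V => fderiv ℝ (m.value (d := d)) p) '' M =
      functionalOfCoeffs '' (n '' M) := by
    rw [Set.image_image]
    exact Set.image_congr fun m _ => m.fderiv_value hp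
  have h2 : Submodule.span ℝ (n '' M) = rowSpan M p.1 := by
    refine le_antisymm (Submodule.span_le.2 ?_) (Submodule.span_le.2 ?_)
    · rintro _ ⟨m, hm, rfl⟩
      exact Submodule.smul_mem _ _ (Submodule.subset_span ⟨m, hm, rfl⟩)
    · rintro _ ⟨m, hm, rfl⟩
      change m.row p.1 ∈ _
      rw [m.row_eq_smul hp]
      exact Submodule.smul_mem _ _ (Submodule.subset_span ⟨m, hm, rfl⟩)
  rw [h1, Submodule.span_image, k.fderiv_value hp,
    ← SetLike.mem_coe, Submodule.map_coe, functionalOfCoeffs_injective.mem_set_image, h2,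
    SetLike.mem_coe]
  constructor
  · intro h
    rw [k.row_eq_smul hp]
    exact Submodule.smul_mem _ _ h
  · exact fun h => Submodule.smul_mem _ _ h

theorem linearIndepOn_row_of_fderiv {p : PseudorangeConfig V d} (hp : Function.Injective p.1)
    {I : Set (Measurement V)}
    (hI : LinearIndepOn ℝ (fun m : Measurement V => fderiv ℝ (m.value (d := d)) p) I) :
    LinearIndepOn ℝ (fun m : Measurement V => m.row p.1) I := by
  have h1 : LinearIndependent ℝ (fun m : I => functionalOfCoeffs
      (‖p.1 m.1.2.1 - p.1 m.1.2.2‖⁻¹ • m.1.row p.1)) := by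
    have : (fun m : I => functionalOfCoeffs (‖p.1 m.1.2.1 - p.1 m.1.2.2‖⁻¹ • m.1.row p.1)) =
        fun m : I => fderiv ℝ (m.1.value (d := d)) p :=
      funext fun m => (m.1.fderiv_value hp).symm
    rw [this]
    exact hI
  have h2 : LinearIndependent ℝ
      (fun m : I => ‖p.1 m.1.2.1 - p.1 m.1.2.2‖⁻¹ • m.1.row p.1) :=
    LinearIndependent.of_comp functionalOfCoeffs h1
  have hne : ∀ m : I, ‖p.1 m.1.2.1 - p.1 m.1.2.2‖ ≠ 0 := fun m h0 => by
    have := h2.ne_zero m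
    rw [h0, inv_zero, zero_smul] at this
    exact this rfl
  have h3 := h2.units_smul fun m => Units.mk0 _ (hne m)
  have : (fun m : I => m.1.row p.1) = _ := funext fun m => m.1.row_eq_smul hp
  change LinearIndependent ℝ fun m : I => m.1.row p.1
  rw [this]
  exact h3

/-- The gradients of the measurements in the graph span the gradients of all measurements. -/
def GNSSGraph.IsInfinitesimallyRigid {V : Type*} (H : GNSSGraph V) (x : SpatialConfig V d) : Prop :=
  ∀ m : Measurement V, m.row x ∈ rowSpan H.measurements x

/-- A generic GNSS framework is rigid if and only if it is infinitesimally rigid. -/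
theorem GNSSGraph.isRigidFramework_iff (hd : 2 ≤ d) (H : GNSSGraph V) {p : PseudorangeConfig V d}
    (hp : PseudorangeConfig.IsGeneric p) :
    H.IsRigidFramework p ↔ H.IsInfinitesimallyRigid p.1 := by
  have hp' : SpatialConfig.IsGeneric p.1 := hp
  have hinj : Function.Injective p.1 := hp'.injective (by omega)
  have hinj' : ∀ᶠ q : PseudorangeConfig V d in 𝓝 p, Function.Injective q.1 := by
    have : ∀ u v : V, ∀ᶠ q : PseudorangeConfig V d in 𝓝 p, q.1 u = q.1 v → u = v := by
      intro u v
      by_cases huv : u = v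
      · exact Eventually.of_forall fun q _ => huv
      · have hc : ContinuousAt (fun q : PseudorangeConfig V d => q.1 u - q.1 v) p := by fun_prop
        filter_upwards [hc.eventually_ne (sub_ne_zero.2 (hinj.ne huv))] with q hq h
        exact (hq (sub_eq_zero.2 h)).elim
    filter_upwards [eventually_all.2 fun u => eventually_all.2 (this u)] with q hq u v
    exact hq u v
  have key := eventually_forall_eq_iff_fderiv_mem_span (p := p)
    (g := fun (m : Measurement V) (q : PseudorangeConfig V d) => m.value q)
    -- Points near `p` need not be generic. Independence is an open condition, however, and with it
    -- the relation at the generic `p` transfers to them.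
    (fun m => m.contDiffAt_value hinj) (fun I hI k hk => by
      have hI' := linearIndepOn_row_of_fderiv hinj hI
      have hk' := (fderiv_value_mem_span_iff hinj I k).1 hk
      have hcont : ContinuousAt
          (fun (q : PseudorangeConfig V d) (m : I) => m.1.row q.1) p := by
        refine continuousAt_pi.2 fun m => continuousAt_pi.2 fun c => ?_
        obtain ⟨⟨⟨a, b⟩, u, v⟩, hm⟩ := m
        rcases c with i | w
        · simp only [Measurement.row, distRow, biasRow, Pi.add_apply, Pi.smul_apply, Sum.elim_inl]
          fun_prop
        · simp only [Measurement.row, distRow, biasRow, Pi.add_apply, Pi.smul_apply, Sum.elim_inr]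
          fun_prop
      have hev := hcont.eventually (LinearIndependent.eventually hI')
      filter_upwards [hev, hinj'] with q hq hqinj
      refine (fderiv_value_mem_span_iff hqinj I k).2 ?_
      rw [rowSpan, Set.image_eq_range] at hk' ⊢
      exact mem_span_of_mem_span_isGeneric hd (z := fun x (m : I) => m.1.row x)
        (w := fun x => k.row x) (fun m c => m.1.row_mem_lengthRing c)
        (fun c => k.row_mem_lengthRing c) hp' hI' hq hk') H.measurements
  simp only [fderiv_value_mem_span_iff hinj] at key
  simp only [GNSSGraph.IsInfinitesimallyRigid]
  rw [← key, Metric.eventually_nhds_iff]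
  simp only [GNSSGraph.IsRigidFramework, GNSSGraph.complete_equivalent_iff,
    GNSSGraph.equivalent_iff H]
  refine exists_congr fun ε => and_congr_right fun _ => forall_congr' fun q => ?_
  rw [dist_comm, dist_eq_norm]

/-- The GNSS graph without pseudorange arcs with the given distance and synchronization edges. -/
def GNSSGraph.ofSimpleGraphs {V : Type*} (GD GS : SimpleGraph V) : GNSSGraph V where
  Γ := ⟨fun _ _ => False, fun _ h => h⟩
  GD := GD
  GS := GS

/-- With all bias differences fixed only the positions matter. This makes the GNSS criterion for
infinitesimal rigidity available for distance rigidity. -/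
theorem isDistanceRigidFramework_iff (G : SimpleGraph V) (p : PseudorangeConfig V d) :
    IsDistanceRigidFramework G p.1 ↔ (GNSSGraph.ofSimpleGraphs G ⊤).IsRigidFramework p := by
  constructor
  · rintro ⟨ε, hε, h⟩
    refine ⟨ε, hε, fun q hq heq => ?_⟩
    have h' := h q.1 (lt_of_le_of_lt (norm_fst_le (p - q)) hq) heq.2.1
    refine ⟨fun u v huv => ?_, h', heq.2.2⟩
    have h1 := h' u v huv
    have h2 := heq.2.2 u v huv
    simp only [PseudorangeConfig.pseudorange]
    linarith
  · rintro ⟨ε, hε, h⟩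
    refine ⟨ε, hε, fun x' hx' heq => ?_⟩
    refine (h (x', p.2) ?_ ⟨fun _ _ h => h.elim, heq, fun _ _ _ => rfl⟩).2.1
    rw [Prod.norm_def]
    simpa [hε] using hx'

end Derivatives

/-! ### Linear algebra -/

section LinearAlgebra

theorem linearIndependent_iff_notMem_span_compl {K E ι : Type*} [DivisionRing K] [AddCommGroup E]
    [Module K E] {v : ι → E} (i : ι) :
    LinearIndependent K v ↔
      LinearIndepOn K v {i}ᶜ ∧ v i ∉ Submodule.span K (v '' {i}ᶜ) := by
  rw [← linearIndepOn_insert (by simp), ← linearIndepOn_univ_iff]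
  have : insert i ({i}ᶜ : Set ι) = Set.univ := by
    ext j
    by_cases h : j = i <;> simp [h]
  rw [this]

/-- From a linearly independent family of sums, summands that form a linearly independent family
can be chosen. -/
theorem LinearIndependent.exists_piecewise {K E ι : Type*} [Field K] [AddCommGroup E] [Module K E]
    [Fintype ι] [DecidableEq ι] {a b : ι → E} (h : LinearIndependent K fun i => a i + b i) :
    ∃ T : Finset ι, LinearIndependent K (T.piecewise a b) := by
  have hker := h.fintypeLinearCombination_injective
  obtain ⟨g, hg⟩ := LinearMap.exists_leftInverse_of_injective _ (LinearMap.ker_eq_bot.2 hker)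
  have hgi : ∀ i, g (a i) + g (b i) = Pi.single i 1 := fun i => by
    have := LinearMap.congr_fun hg (Pi.single i 1)
    simpa [Fintype.linearCombination_apply_single] using this
  -- The left inverse `g` sends the sums to the standard basis. The determinant expands into one
  -- term for each choice of summands, and some term must be nonzero.
  have hdet : Matrix.detRowAlternating ((fun i => g (a i)) + fun i => g (b i)) = (1 : K) := by
    have : ((fun i => g (a i)) + fun i => g (b i)) = (1 : Matrix ι ι K) := by
      funext i j
      have := congrFun (hgi i) j
      simpa [Matrix.one_apply, Pi.single_apply, eq_comm] using this
    rw [this]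
    exact Matrix.det_one
  rw [AlternatingMap.map_add_univ] at hdet
  obtain ⟨T, -, hT⟩ := Finset.exists_ne_zero_of_sum_ne_zero (by rw [hdet]; exact one_ne_zero)
  refine ⟨T, LinearIndependent.of_comp g ?_⟩
  have hgT : g ∘ T.piecewise a b = T.piecewise (fun i => g (a i)) fun i => g (b i) := by
    funext i
    by_cases hi : i ∈ T <;> simp [hi]
  rw [hgT]
  exact Matrix.linearIndependent_rows_of_det_ne_zero hT

/-- As all vectors have entries in `L`, a functional `f` with coefficients in `L` separates `a` or
`b` from `S`. Membership would give `f a + t * f b = 0`, which forces `t ∈ L` unless `f a` and `f b`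
both vanish. -/
theorem add_smul_notMem_span {κ : Type*} [Finite κ] {L : Subfield ℝ} {t : ℝ} (ht : t ∉ L)
    {S : Set (κ → ℝ)} (hS : ∀ z ∈ S, ∀ k, z k ∈ L) {a b : κ → ℝ} (ha : ∀ k, a k ∈ L)
    (hb : ∀ k, b k ∈ L) (h : a ∉ Submodule.span ℝ S ∨ b ∉ Submodule.span ℝ S) :
    a + t • b ∉ Submodule.span ℝ S := by
  classical
  have := Fintype.ofFinite κ
  set S' : Set (κ → L) := {z | (fun k => (z k : ℝ)) ∈ S} with hS'
  have hspan : ∀ z ∈ Submodule.span L S', (fun k => (z k : ℝ)) ∈ Submodule.span ℝ S := by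
    intro z hz
    induction hz using Submodule.span_induction with
    | mem z hz => exact Submodule.subset_span hz
    | zero => exact Submodule.zero_mem _
    | add y z _ _ hy hz => exact Submodule.add_mem _ hy hz
    | smul c z _ hz => exact Submodule.smul_mem _ (c : ℝ) hz
  have hfun : ∀ c : κ → ℝ, (∀ k, c k ∈ L) → c ∉ Submodule.span ℝ S →
      ∃ f : κ → L, (∀ z ∈ S, ∑ k, z k * f k = 0) ∧ ∑ k, c k * f k ≠ 0 := by
    intro c hc hcS
    have hc' : (fun k => (⟨c k, hc k⟩ : L)) ∉ Submodule.span L S' := fun h => hcS (hspan _ h)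
    obtain ⟨g, hg, hgS⟩ := Submodule.exists_le_ker_of_notMem hc'
    have hgsum : ∀ z : κ → L, ((g z : L) : ℝ) = ∑ k, (z k : ℝ) * g (Pi.single k 1) := by
      intro z
      have hs : ∀ k, (Pi.single k 1 : κ → L) = fun j => if k = j then 1 else 0 := fun k =>
        funext fun j => by simp [Pi.single_apply, eq_comm]
      rw [LinearMap.pi_apply_eq_sum_univ g z]
      simp [hs]
    refine ⟨fun k => g (Pi.single k 1), fun z hz => ?_, ?_⟩
    · have h0 : g (fun k => (⟨z k, hS z hz k⟩ : L)) = 0 := hgS (Submodule.subset_span hz)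
      rw [← hgsum fun k => (⟨z k, hS z hz k⟩ : L), h0]
      rfl
    · rw [← hgsum fun k => (⟨c k, hc k⟩ : L)]
      simpa using hg
  have hzero : ∀ f : κ → L, (∀ z ∈ S, ∑ k, z k * f k = 0) → ∀ z ∈ Submodule.span ℝ S,
      ∑ k, z k * (f k : ℝ) = 0 := by
    intro f hf z hz
    induction hz using Submodule.span_induction with
    | mem z hz => exact hf z hz
    | zero => simp
    | add y z _ _ hy hz => simp [add_mul, Finset.sum_add_distrib, hy, hz]
    | smul c z _ hz => simp [mul_assoc, ← Finset.mul_sum, hz]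
  intro hmem
  have hL : ∀ (f : κ → L) (c : κ → ℝ), (∀ k, c k ∈ L) → ∑ k, c k * (f k : ℝ) ∈ L :=
    fun f c hc => sum_mem fun k _ => L.mul_mem (hc k) (f k).2
  have hexp : ∀ f : κ → L, ∑ k, (a + t • b) k * (f k : ℝ) =
      ∑ k, a k * (f k : ℝ) + t * ∑ k, b k * (f k : ℝ) := fun f => by
    simp [add_mul, Finset.sum_add_distrib, Finset.mul_sum, mul_assoc]
  have hsolve : ∀ f : κ → L, ∑ k, b k * (f k : ℝ) ≠ 0 →
      ∑ k, a k * (f k : ℝ) + t * ∑ k, b k * (f k : ℝ) = 0 → t ∈ L := by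
    intro f hne h0
    have : t = -(∑ k, a k * (f k : ℝ)) / ∑ k, b k * (f k : ℝ) := by
      field_simp
      linear_combination h0
    rw [this]
    exact L.div_mem (L.neg_mem (hL f a ha)) (hL f b hb)
  rcases h with h | h
  · obtain ⟨f, hf, hne⟩ := hfun a ha h
    have h0 := hzero f hf _ hmem
    rw [hexp] at h0
    refine ht (hsolve f (fun hb0 => hne ?_) h0)
    simpa [hb0] using h0
  · obtain ⟨f, hf, hne⟩ := hfun b hb h
    have h0 := hzero f hf _ hmem
    rw [hexp] at h0
    exact ht (hsolve f hne h0)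

/-- In a linearly independent family, vectors `a i` or `b i` can be replaced by `a i + t i • b i` if
`t i` does not lie in a field that contains the entries of all other vectors involved. -/
theorem LinearIndependent.piecewise_add_smul {ι κ : Type*} [DecidableEq ι] [Finite κ] {t : ι → ℝ}
    {L : ι → Subfield ℝ} {M : Finset ι} {a b c : ι → κ → ℝ} (hc : LinearIndependent ℝ c)
    (habc : ∀ i ∈ M, c i = a i ∨ c i = b i) (ht : ∀ i ∈ M, t i ∉ L i)
    (htL : ∀ i ∈ M, ∀ j ∈ M, j ≠ i → t j ∈ L i) (haL : ∀ i ∈ M, ∀ j k, a j k ∈ L i)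
    (hbL : ∀ i ∈ M, ∀ j k, b j k ∈ L i) (hcL : ∀ i ∈ M, ∀ j k, c j k ∈ L i) :
    LinearIndependent ℝ (M.piecewise (fun i => a i + t i • b i) c) := by
  -- Vectors are replaced one at a time. When `i` is treated, those already replaced have entries in
  -- `L i`, because it contains every `t j` with `j ∈ M` and `j ≠ i`.
  suffices ∀ s ⊆ M, LinearIndependent ℝ (s.piecewise (fun i => a i + t i • b i) c) from
    this M subset_rfl
  intro s
  induction s using Finset.induction_on with
  | empty => simpa using hc
  | insert i s his ih =>
    intro hs
    have hiM := hs (Finset.mem_insert_self i s)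
    have hsM : s ⊆ M := (Finset.subset_insert i s).trans hs
    have ih := (linearIndependent_iff_notMem_span_compl i).1 (ih hsM)
    have hcongr : Set.EqOn (s.piecewise (fun i => a i + t i • b i) c)
        ((insert i s).piecewise (fun i => a i + t i • b i) c) {i}ᶜ := by
      intro j hj
      have hj' : j ≠ i := hj
      by_cases hjs : j ∈ s <;> simp [Finset.piecewise, hjs, hj']
    refine (linearIndependent_iff_notMem_span_compl i).2 ⟨ih.1.congr hcongr, ?_⟩
    rw [← Set.image_congr hcongr, Finset.piecewise_eq_of_mem _ _ _ (Finset.mem_insert_self i s)]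
    have hci := ih.2
    rw [Finset.piecewise_eq_of_notMem _ _ _ his] at hci
    refine add_smul_notMem_span (ht i hiM) ?_ (haL i hiM i) (hbL i hiM i) ?_
    · rintro _ ⟨j, hj, rfl⟩ k
      by_cases hjs : j ∈ s
      · rw [Finset.piecewise_eq_of_mem _ _ _ hjs]
        exact (L i).add_mem (haL i hiM j k)
          ((L i).mul_mem (htL i hiM j (hsM hjs) hj) (hbL i hiM j k))
      · rw [Finset.piecewise_eq_of_notMem _ _ _ hjs]
        exact hcL i hiM j k
    · rcases habc i hiM with h | h
      · exact Or.inl (h ▸ hci)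
      · exact Or.inr (h ▸ hci)

/-- A dimension count: an exchanged family that stays independent and inside the old span has lost
nothing. -/
theorem LinearIndependent.span_eq_of_mem_span {K E ι : Type*} [DivisionRing K] [AddCommGroup E]
    [Module K E] [Finite ι] {v w : ι → E} (hv : LinearIndependent K v) (hw : LinearIndependent K w)
    (h : ∀ i, w i ∈ Submodule.span K (Set.range v)) :
    Submodule.span K (Set.range w) = Submodule.span K (Set.range v) := by
  have := Fintype.ofFinite ι
  have : FiniteDimensional K (Submodule.span K (Set.range v)) :=
    FiniteDimensional.span_of_finite K (Set.finite_range v)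
  refine Submodule.eq_of_le_of_finrank_eq (Submodule.span_le.2 ?_) ?_
  · rintro _ ⟨i, rfl⟩
    exact h i
  · rw [finrank_span_eq_card hv, finrank_span_eq_card hw]

end LinearAlgebra

/-! ### Multiplicities of undirected edges -/

section Multiplicity

variable {V : Type*}

open Classical in
theorem PseudorangeGraph.mult_undirected (Γ : PseudorangeGraph V) (u v : V) :
    Γ.undirected.mult s(u, v) = (if Γ.Arc u v then 1 else 0) + (if Γ.Arc v u then 1 else 0) := by
  change (Γ.arcsOver s(u, v)).ncard = _
  by_cases huv : u = v
  · subst huv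
    have := Γ.undirected.mult_diag u
    change (Γ.arcsOver s(u, u)).ncard = 0 at this
    simp [this, Γ.loopless u]
  have hover : Γ.arcsOver s(u, v) =
      (if Γ.Arc u v then {(u, v)} else ∅) ∪ (if Γ.Arc v u then {(v, u)} else ∅) := by
    ext ⟨a, b⟩
    simp only [PseudorangeGraph.arcsOver, Set.mem_ofPred_eq, Sym2.eq_iff, Set.mem_union]
    constructor
    · rintro ⟨h, ⟨rfl, rfl⟩ | ⟨rfl, rfl⟩⟩
      · simp [h]
      · simp [h]
    · rintro (h | h)
      · split_ifs at h with h'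
        · obtain ⟨rfl, rfl⟩ := Prod.ext_iff.1 h
          exact ⟨h', Or.inl ⟨rfl, rfl⟩⟩
        · exact h.elim
      · split_ifs at h with h'
        · obtain ⟨rfl, rfl⟩ := Prod.ext_iff.1 h
          exact ⟨h', Or.inr ⟨rfl, rfl⟩⟩
        · exact h.elim
  rw [hover]
  by_cases h1 : Γ.Arc u v <;> by_cases h2 : Γ.Arc v u
  · simp only [h1, h2, if_true, Set.singleton_union]
    rw [Set.ncard_pair (fun h => huv (Prod.ext_iff.1 h).1)]
  · simp [h1, h2]
  · simp [h1, h2]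
  · simp [h1, h2]

theorem PseudorangeGraph.arc_of_mult_eq_two {Γ : PseudorangeGraph V} {u v : V}
    (h : Γ.undirected.mult s(u, v) = 2) : Γ.Arc u v := by
  classical
  by_contra h'
  rw [Γ.mult_undirected, if_neg h'] at h
  split_ifs at h <;> omega

theorem PseudorangeGraph.arc_or_arc_of_mult_eq_one {Γ : PseudorangeGraph V} {u v : V}
    (h : Γ.undirected.mult s(u, v) = 1) : Γ.Arc u v ∨ Γ.Arc v u := by
  classical
  by_contra! h'
  rw [Γ.mult_undirected, if_neg h'.1, if_neg h'.2] at h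
  omega

theorem PseudorangeGraph.mult_of_arc {Γ : PseudorangeGraph V} {u v : V} (h : Γ.Arc u v) :
    Γ.undirected.mult s(u, v) = 2 ∨ Γ.undirected.mult s(u, v) = 1 ∧ ¬ Γ.Arc v u := by
  classical
  rw [Γ.mult_undirected, if_pos h]
  by_cases h' : Γ.Arc v u <;> simp [h']

/-- Every undirected multigraph with multiplicities at most two has an orientation without parallel
arcs. -/
theorem UndirectedPseudorangeGraph.exists_undirected_eq (Γ : UndirectedPseudorangeGraph V) :
    ∃ Γ' : PseudorangeGraph V, Γ'.undirected = Γ := by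
  classical
  let Γ' : PseudorangeGraph V :=
    -- A single edge is oriented by the chosen representative `out` of the unordered pair.
    { Arc := fun u v => Γ.mult s(u, v) = 2 ∨ Γ.mult s(u, v) = 1 ∧ s(u, v).out = (u, v)
      loopless := fun v => by simp [Γ.mult_diag v] }
  refine ⟨Γ', UndirectedPseudorangeGraph.ext (funext fun e => ?_)⟩
  induction e using Sym2.ind with
  | _ u v =>
  rw [Γ'.mult_undirected]
  have hswap : s(v, u) = s(u, v) := Sym2.eq_swap
  have hle := Γ.mult_le_two s(u, v)
  by_cases huv : u = v
  · subst huv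
    rw [if_neg (Γ'.loopless u), Γ.mult_diag]
  have hout : s(u, v).out = (u, v) ∨ s(u, v).out = (v, u) := by
    have h : s((s(u, v).out).1, (s(u, v).out).2) = s(u, v) := Quot.out_eq _
    rcases Sym2.eq_iff.1 h with h | h
    · exact Or.inl (Prod.ext h.1 h.2)
    · exact Or.inr (Prod.ext h.1 h.2)
  have hne : (u, v) ≠ (v, u) := fun h => huv (Prod.ext_iff.1 h).1
  simp only [Γ', hswap]
  obtain h | h | h : Γ.mult s(u, v) = 0 ∨ Γ.mult s(u, v) = 1 ∨ Γ.mult s(u, v) = 2 := by omega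
  · simp [h]
  · rcases hout with h' | h'
    · simp [h, h', huv]
    · simp [h, h', Ne.symm huv]
  · simp [h]

theorem UndirectedGNSSGraph.exists_undirected_eq (G : UndirectedGNSSGraph V) :
    ∃ H : GNSSGraph V, H.undirected = G := by
  obtain ⟨Γ, hΓ⟩ := G.Γ.exists_undirected_eq
  refine ⟨⟨Γ, G.GD, G.GS⟩, ?_⟩
  rw [GNSSGraph.undirected, hΓ]

end Multiplicity

/-! ### Existence of generic configurations -/

/-- A transcendence basis of `ℝ` over `ℤ` is infinite, since otherwise `ℝ` would be countable.
Distinct basis elements serve as coordinates. -/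
theorem exists_isGeneric (V : Type*) [Finite V] (d : ℕ) : ∃ x : SpatialConfig V d, x.IsGeneric := by
  obtain ⟨s, hs⟩ := exists_isTranscendenceBasis ℤ ℝ
  have hinf : Infinite s := by
    by_contra hfin
    rw [not_infinite_iff_finite] at hfin
    have halg := hs.isAlgebraic
    have hcount : Countable (Algebra.adjoin ℤ (Set.range ((↑) : s → ℝ))) := by
      have : Countable (MvPolynomial s ℤ) :=
        Cardinal.mk_le_aleph0_iff.1 (MvPolynomial.cardinalMk_le_max.trans (by simp))
      rw [Algebra.adjoin_range_eq_range_aeval]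
      exact (MvPolynomial.aeval ((↑) : s → ℝ) :
        MvPolynomial s ℤ →ₐ[ℤ] ℝ).rangeRestrict_surjective.countable
    have h1 := Algebra.IsAlgebraic.cardinalMk_le_max
      (Algebra.adjoin ℤ (Set.range ((↑) : s → ℝ))) ℝ
    have h2 : Cardinal.mk (Algebra.adjoin ℤ (Set.range ((↑) : s → ℝ))) ≤ Cardinal.aleph0 :=
      Cardinal.mk_le_aleph0
    rw [max_eq_right h2, Cardinal.mk_real] at h1
    exact absurd h1 (not_le.2 Cardinal.aleph0_lt_continuum)
  have : Fintype V := Fintype.ofFinite V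
  let f : V × Fin d ↪ s := (Fintype.equivFin (V × Fin d)).toEmbedding.trans
    (Fin.valEmbedding.trans (Infinite.natEmbedding s))
  have hind : AlgebraicIndependent ℤ fun i => ((f i : s) : ℝ) :=
    hs.1.comp f f.injective
  refine ⟨fun v => WithLp.toLp 2 fun j => ((f (v, j) : s) : ℝ), fun P hP => ?_⟩
  exact (injective_iff_map_eq_zero _).1 hind P hP

/-! ### Infinitesimal rigidity -/

section InfinitesimalRigidity

variable {V : Type*} {d : ℕ}

theorem exists_linearIndepOn_span_eq {K E ι : Type*} [DivisionRing K] [AddCommGroup E] [Module K E]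
    (v : ι → E) (M : Set ι) : ∃ I ⊆ M, LinearIndepOn K v I ∧
      Submodule.span K (v '' I) = Submodule.span K (v '' M) := by
  obtain ⟨I, hI, -, hM, hind⟩ :=
    exists_linearIndepOn_extension (linearIndepOn_empty K v) (Set.empty_subset M)
  exact ⟨I, hI, hind, le_antisymm (Submodule.span_mono (Set.image_mono hI)) (Submodule.span_le.2 hM)⟩

theorem row_mem_rowSpan {M : Set (Measurement V)} {m : Measurement V} (hm : m ∈ M)
    (x : SpatialConfig V d) : m.row x ∈ rowSpan M x :=
  Submodule.subset_span ⟨m, hm, rfl⟩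

theorem GNSSGraph.isInfinitesimallyRigid_iff {H : GNSSGraph V} {x : SpatialConfig V d} :
    H.IsInfinitesimallyRigid x ↔ rowSpan H.measurements x = rowSpan Set.univ x := by
  constructor
  · intro h
    refine le_antisymm (Submodule.span_mono (Set.image_mono (Set.subset_univ _)))
      (Submodule.span_le.2 ?_)
    rintro _ ⟨m, -, rfl⟩
    exact h m
  · intro h m
    rw [h]
    exact row_mem_rowSpan (Set.mem_univ m) x

/-- Fix a basis of the row space at `x` among the rows of `H`. Both its independence and the
membership of further rows in its span carry over to `y`. -/
theorem GNSSGraph.IsInfinitesimallyRigid.of_isGeneric [Fintype V] (hd : 2 ≤ d) {H : GNSSGraph V}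
    {x y : SpatialConfig V d} (h : H.IsInfinitesimallyRigid x) (hx : x.IsGeneric)
    (hy : y.IsGeneric) : H.IsInfinitesimallyRigid y := by
  intro k
  obtain ⟨I, hIM, hI, hspan⟩ :=
    exists_linearIndepOn_span_eq (K := ℝ) (fun m : Measurement V => m.row x) H.measurements
  have hk : k.row x ∈ rowSpan I x := by
    have := h k
    rwa [rowSpan, ← hspan] at this
  refine Submodule.span_mono (Set.image_mono hIM) ?_
  rw [rowSpan, Set.image_eq_range] at hk
  rw [Set.image_eq_range]
  exact mem_span_of_mem_span_isGeneric hd (z := fun x (m : I) => m.1.row x) (w := fun x => k.row x)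
    (fun m c => m.1.row_mem_lengthRing c) (fun c => k.row_mem_lengthRing c) hx hI
    (linearIndependent_of_isGeneric hd (z := fun x (m : I) => m.1.row x)
      (fun m c => m.1.row_mem_lengthRing c) hy hI) hk

theorem row_dist (x : SpatialConfig V d) (u v : V) :
    Measurement.row ((true, false), u, v) x = distRow x u v := by
  simp [Measurement.row, Measurement.distCoeff, Measurement.biasCoeff]

theorem row_bias (x : SpatialConfig V d) (u v : V) :
    Measurement.row ((false, true), u, v) x = ‖x u - x v‖ • biasRow d u v := by
  simp [Measurement.row, Measurement.distCoeff, Measurement.biasCoeff]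

theorem row_pseudorange (x : SpatialConfig V d) (u v : V) :
    Measurement.row ((true, true), u, v) x = distRow x u v + ‖x u - x v‖ • biasRow d u v := by
  simp [Measurement.row, Measurement.distCoeff, Measurement.biasCoeff]

theorem biasRow_mem_rowSpan {x : SpatialConfig V d} (hx : Function.Injective x)
    {M : Set (Measurement V)} {u v : V} (h : ((false, true), u, v) ∈ M) :
    biasRow d u v ∈ rowSpan M x := by
  by_cases huv : u = v
  · subst huv
    rw [biasRow_self]
    exact Submodule.zero_mem _
  · have hne : ‖x u - x v‖ ≠ 0 := norm_ne_zero_iff.2 (sub_ne_zero.2 (hx.ne huv))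
    refine (Submodule.smul_mem_iff _ hne).1 ?_
    rw [← row_bias]
    exact row_mem_rowSpan h x

theorem biasRow_add_biasRow (u v w : V) : biasRow d u v + biasRow d v w = biasRow d u w := by
  funext c
  rcases c with i | c
  · simp [biasRow]
  · simp [biasRow]

/-- A connected synchronization graph is as good as the complete one. -/
theorem GNSSGraph.IsInfinitesimallyRigid.of_connected {GD GS : SimpleGraph V}
    {x : SpatialConfig V d} (hx : Function.Injective x)
    (h : (GNSSGraph.ofSimpleGraphs GD ⊤).IsInfinitesimallyRigid x) (hGS : GS.Connected) :
    (GNSSGraph.ofSimpleGraphs GD GS).IsInfinitesimallyRigid x := by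
  have hwalk : ∀ u v : V, GS.Walk u v →
      biasRow d u v ∈ rowSpan (GNSSGraph.ofSimpleGraphs GD GS).measurements x := by
    intro u v p
    induction p with
    | nil => rw [biasRow_self]; exact Submodule.zero_mem _
    | @cons u v w huv _ ih =>
      rw [← biasRow_add_biasRow u v w]
      exact Submodule.add_mem _ (biasRow_mem_rowSpan hx (Or.inr (Or.inr ⟨rfl, huv⟩))) ih
  intro k
  refine (Submodule.span_le.2 ?_ : rowSpan _ x ≤ _) (h k)
  rintro _ ⟨⟨⟨a, b⟩, u, v⟩, ⟨-, h⟩ | ⟨hab, h⟩ | ⟨hab, h⟩, rfl⟩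
  · exact h.elim
  · exact row_mem_rowSpan (Or.inr (Or.inl ⟨hab, h⟩)) x
  · obtain ⟨rfl, rfl⟩ := Prod.ext_iff.1 hab
    obtain ⟨p⟩ := hGS.preconnected u v
    change Measurement.row ((false, true), u, v) x ∈ _
    rw [row_bias]
    exact Submodule.smul_mem _ _ (hwalk u v p)

theorem GNSSGraph.IsInfinitesimallyRigid.top_right {GD GS : SimpleGraph V}
    {x : SpatialConfig V d} (h : (GNSSGraph.ofSimpleGraphs GD GS).IsInfinitesimallyRigid x) :
    (GNSSGraph.ofSimpleGraphs GD ⊤).IsInfinitesimallyRigid x := by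
  intro k
  refine Submodule.span_mono (Set.image_mono ?_) (h k)
  rintro m (⟨-, h⟩ | h | ⟨hm, h⟩)
  · exact h.elim
  · exact Or.inr (Or.inl h)
  · exact Or.inr (Or.inr ⟨hm, SimpleGraph.Adj.ne h⟩)

/-- Shifting all clocks in the component of `u` by the same amount is annihilated by every row of
the graph, but it changes the bias difference to any agent outside that component. -/
theorem GNSSGraph.IsInfinitesimallyRigid.connected [Fintype V] [Nonempty V] {GD GS : SimpleGraph V}
    {x : SpatialConfig V d} (hx : Function.Injective x)
    (h : (GNSSGraph.ofSimpleGraphs GD GS).IsInfinitesimallyRigid x) : GS.Connected := by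
  classical
  refine ⟨fun u v => ?_⟩
  by_cases huv : u = v
  · subst huv; exact SimpleGraph.Reachable.refl u
  set p : PseudorangeConfig V d := (0, fun w => if GS.Reachable u w then 1 else 0) with hp
  have hzero : ∀ w ∈ rowSpan (GNSSGraph.ofSimpleGraphs GD GS).measurements x,
      functionalOfCoeffs w p = 0 := by
    intro w hw
    induction hw using Submodule.span_induction with
    | mem w hw =>
      obtain ⟨⟨⟨a, b⟩, s, t⟩, ⟨-, h⟩ | ⟨hab, h⟩ | ⟨hab, h⟩, rfl⟩ := hw
      · exact h.elim
      · obtain ⟨rfl, rfl⟩ := Prod.ext_iff.1 hab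
        change functionalOfCoeffs (Measurement.row ((true, false), s, t) x) p = 0
        rw [row_dist, functionalOfCoeffs_distRow]
        simp [hp]
      · obtain ⟨rfl, rfl⟩ := Prod.ext_iff.1 hab
        have hst : GS.Reachable u t ↔ GS.Reachable u s :=
          ⟨fun h' => h'.trans (SimpleGraph.Adj.reachable h).symm,
            fun h' => h'.trans (SimpleGraph.Adj.reachable h)⟩
        change functionalOfCoeffs (Measurement.row ((false, true), s, t) x) p = 0
        rw [row_bias, map_smul, _root_.smul_apply, functionalOfCoeffs_biasRow]
        simp [hp, hst]
    | zero => simp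
    | add y z _ _ hy hz => rw [map_add, _root_.add_apply, hy, hz, add_zero]
    | smul c z _ hz => rw [map_smul, _root_.smul_apply, hz, smul_zero]
  have h0 := hzero _ (h ((false, true), u, v))
  rw [row_bias, map_smul, _root_.smul_apply, functionalOfCoeffs_biasRow, smul_eq_mul] at h0
  have hne : ‖x u - x v‖ ≠ 0 := norm_ne_zero_iff.2 (sub_ne_zero.2 (hx.ne huv))
  have h1 := (mul_eq_zero.1 h0).resolve_left hne
  by_contra hr
  simp [hp, hr] at h1

/-- The measurements of an infinitesimally rigid GNSS graph can be split into distances and bias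
differences without losing infinitesimal rigidity. -/
theorem GNSSGraph.IsInfinitesimallyRigid.exists_isDecomposition [Finite V] {H : GNSSGraph V}
    {x : SpatialConfig V d} (hx : Function.Injective x) (h : H.IsInfinitesimallyRigid x) :
    ∃ GD GS : SimpleGraph V, H.undirected.IsDecomposition GD GS ∧
      (GNSSGraph.ofSimpleGraphs GD GS).IsInfinitesimallyRigid x := by
  classical
  have := Fintype.ofFinite V
  obtain ⟨I, hIM, hI, hspan⟩ :=
    exists_linearIndepOn_span_eq (K := ℝ) (fun m : Measurement V => m.row x) H.measurements
  have hIW : Submodule.span ℝ (Set.range fun m : I => m.1.row x) = rowSpan Set.univ x := by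
    rw [← isInfinitesimallyRigid_iff.1 h, rowSpan, ← hspan, Set.image_eq_range]
  set a : I → ConfigCoord V d → ℝ := fun m => m.1.distCoeff • distRow x m.1.2.1 m.1.2.2 with ha
  set b : I → ConfigCoord V d → ℝ :=
    fun m => (m.1.biasCoeff * ‖x m.1.2.1 - x m.1.2.2‖) • biasRow d m.1.2.1 m.1.2.2 with hb
  obtain ⟨T, hT⟩ := LinearIndependent.exists_piecewise (a := a) (b := b) hI
  let chosen : Set (Measurement V) := {m | ∃ hm : m ∈ I, (⟨m, hm⟩ : I) ∈ T}
  -- A single edge carries just one arc, so its assignment is unambiguous. It becomes a distance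
  -- edge if the basis row of that arc kept its distance part, and a synchronization edge otherwise,
  -- also when the arc is not in `I`.
  let byDist (u v : V) : Prop :=
    ((true, true), u, v) ∈ chosen ∨ ((true, true), v, u) ∈ chosen
  have hbyDist : ∀ u v, byDist u v ↔ byDist v u := fun u v => or_comm
  set μ := H.Γ.undirected.mult with hμ
  have hsymm : ∀ u v, μ s(v, u) = μ s(u, v) := fun u v => by rw [Sym2.eq_swap]
  let GPD : SimpleGraph V :=
    { Adj := fun u v => μ s(u, v) = 2 ∨ μ s(u, v) = 1 ∧ byDist u v
      symm := ⟨fun u v h => by rwa [hsymm u v, hbyDist v u]⟩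
      loopless := ⟨fun v h => by simp [hμ, H.Γ.undirected.mult_diag v] at h⟩ }
  let GPS : SimpleGraph V :=
    { Adj := fun u v => μ s(u, v) = 2 ∨ μ s(u, v) = 1 ∧ ¬ byDist u v
      symm := ⟨fun u v h => by rwa [hsymm u v, hbyDist v u]⟩
      loopless := ⟨fun v h => by simp [hμ, H.Γ.undirected.mult_diag v] at h⟩ }
  have hdec : H.Γ.undirected.IsDecomposition GPD GPS := by
    constructor
    · ext e
      induction e using Sym2.ind with
      | _ u v =>
        change (_ ∨ _) ∨ (_ ∨ _) ↔ μ s(u, v) = 1 ∨ μ s(u, v) = 2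
        tauto
    · ext e
      induction e using Sym2.ind with
      | _ u v =>
        change (_ ∨ _) ∧ (_ ∨ _) ↔ μ s(u, v) = 2
        tauto
  refine ⟨H.GD ⊔ GPD, H.GS ⊔ GPS, ⟨GPD, GPS, hdec, SimpleGraph.edgeSet_sup _ _,
    SimpleGraph.edgeSet_sup _ _⟩, ?_⟩
  set N := (GNSSGraph.ofSimpleGraphs (H.GD ⊔ GPD) (H.GS ⊔ GPS)).measurements with hN
  have hD : ∀ {u v}, (H.GD ⊔ GPD).Adj u v → distRow x u v ∈ rowSpan N x := fun {u v} huv => by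
    rw [← row_dist]
    exact row_mem_rowSpan (Or.inr (Or.inl ⟨rfl, huv⟩)) x
  have hS : ∀ {u v}, (H.GS ⊔ GPS).Adj u v → biasRow d u v ∈ rowSpan N x := fun {u v} huv =>
    biasRow_mem_rowSpan hx (Or.inr (Or.inr ⟨rfl, huv⟩))
  have hmemN : ∀ m, T.piecewise a b m ∈ rowSpan N x := by
    rintro ⟨⟨⟨s, t⟩, u, v⟩, hm⟩
    have hmH := hIM hm
    by_cases hmT : (⟨((s, t), u, v), hm⟩ : I) ∈ T
    · rw [Finset.piecewise_eq_of_mem _ _ _ hmT]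
      rcases hmH with ⟨hst, huv⟩ | ⟨hst, huv⟩ | ⟨hst, huv⟩ <;>
        obtain ⟨rfl, rfl⟩ := Prod.ext_iff.1 hst
      · refine Submodule.smul_mem _ _ (hD (Or.inr ?_))
        rcases PseudorangeGraph.mult_of_arc huv with h | ⟨h, -⟩
        · exact Or.inl h
        · exact Or.inr ⟨h, Or.inl ⟨hm, hmT⟩⟩
      · exact Submodule.smul_mem _ _ (hD (Or.inl huv))
      · simp [ha, Measurement.distCoeff]
    · rw [Finset.piecewise_eq_of_notMem _ _ _ hmT]
      rcases hmH with ⟨hst, huv⟩ | ⟨hst, huv⟩ | ⟨hst, huv⟩ <;>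
        obtain ⟨rfl, rfl⟩ := Prod.ext_iff.1 hst
      · refine Submodule.smul_mem _ _ (hS (Or.inr ?_))
        rcases PseudorangeGraph.mult_of_arc huv with h | ⟨h, hvu⟩
        · exact Or.inl h
        · refine Or.inr ⟨h, ?_⟩
          rintro (⟨_, h'⟩ | ⟨hm', -⟩)
          · exact hmT h'
          · rcases hIM hm' with ⟨-, hvu'⟩ | ⟨h', -⟩ | ⟨h', -⟩
            · exact hvu hvu'
            · simp at h'
            · simp at h'
      · simp [hb, Measurement.biasCoeff]
      · exact Submodule.smul_mem _ _ (hS (Or.inl huv))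
  have hmemW : ∀ m, T.piecewise a b m ∈ Submodule.span ℝ (Set.range fun m : I => m.1.row x) := by
    rintro ⟨⟨⟨s, t⟩, u, v⟩, hm⟩
    rw [hIW]
    by_cases hmT : (⟨((s, t), u, v), hm⟩ : I) ∈ T
    · rw [Finset.piecewise_eq_of_mem _ _ _ hmT]
      refine Submodule.smul_mem _ _ ?_
      rw [← row_dist]
      exact row_mem_rowSpan (Set.mem_univ _) x
    · rw [Finset.piecewise_eq_of_notMem _ _ _ hmT]
      exact Submodule.smul_mem _ _ (biasRow_mem_rowSpan hx (Set.mem_univ _))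
  -- The rows indexed by `I` already span everything, so the equally many independent summands do
  -- too.
  have hspan' := LinearIndependent.span_eq_of_mem_span hI hT hmemW
  intro k
  have hk : k.row x ∈ Submodule.span ℝ (Set.range (T.piecewise a b)) := by
    rw [hspan', hIW]
    exact row_mem_rowSpan (Set.mem_univ _) x
  refine Submodule.span_le.2 ?_ hk
  rintro _ ⟨m, rfl⟩
  exact hmemN m

/-- The coefficient vector of a measurement, with unscaled bias differences. -/
noncomputable def Measurement.pureRow (m : Measurement V) (x : SpatialConfig V d) :
    ConfigCoord V d → ℝ :=
  m.distCoeff • distRow x m.2.1 m.2.2 + m.biasCoeff • biasRow d m.2.1 m.2.2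

theorem distRow_mem_lengthField (x : SpatialConfig V d) (u v : V) (c : ConfigCoord V d)
    (e : Sym2 V) : distRow x u v c ∈ lengthField x e :=
  apply_mem_lengthField (distRow_mem_lengthRing u v c ∅) x (Set.notMem_empty e)

theorem biasRow_mem_lengthField (x : SpatialConfig V d) (u v : V) (c : ConfigCoord V d)
    (e : Sym2 V) : biasRow d u v c ∈ lengthField x e :=
  apply_mem_lengthField (biasRow_mem_lengthRing u v c ∅) x (Set.notMem_empty e)

/-- Leaving the bias part unscaled keeps the edge's own length out of the entries, so they lie in
`lengthField x e` even for that edge. -/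
theorem pureRow_mem_lengthField (m : Measurement V) (x : SpatialConfig V d) (c : ConfigCoord V d)
    (e : Sym2 V) : m.pureRow x c ∈ lengthField x e := by
  have hcoeff : ∀ t : Bool, (if t then 1 else 0 : ℝ) ∈ lengthField x e := fun t => by
    split_ifs
    · exact one_mem _
    · exact zero_mem _
  exact add_mem (mul_mem (hcoeff _) (distRow_mem_lengthField x _ _ c e))
    (mul_mem (hcoeff _) (biasRow_mem_lengthField x _ _ c e))

/-- A GNSS graph with a decomposition into two simple graphs that together are infinitesimally
rigid is infinitesimally rigid. -/
theorem GNSSGraph.IsInfinitesimallyRigid.of_isDecomposition [Finite V] (hd : 2 ≤ d)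
    {H : GNSSGraph V} {x : SpatialConfig V d} (hx : x.IsGeneric) {GD GS : SimpleGraph V}
    (hdec : H.undirected.IsDecomposition GD GS)
    (h : (GNSSGraph.ofSimpleGraphs GD GS).IsInfinitesimallyRigid x) :
    H.IsInfinitesimallyRigid x := by
  classical
  have := Fintype.ofFinite V
  have hinj : Function.Injective x := hx.injective (by omega)
  obtain ⟨GPD, GPS, ⟨hunion, hinter⟩, hGD, hGS⟩ := hdec
  set μ := H.Γ.undirected.mult with hμ
  have hGD' : ∀ {u v}, GD.Adj u v → H.GD.Adj u v ∨ GPD.Adj u v := fun {u v} huv => by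
    rw [← SimpleGraph.mem_edgeSet, hGD] at huv
    exact huv
  have hGS' : ∀ {u v}, GS.Adj u v → H.GS.Adj u v ∨ GPS.Adj u v := fun {u v} huv => by
    rw [← SimpleGraph.mem_edgeSet, hGS] at huv
    exact huv
  have hPD : ∀ {u v}, GPD.Adj u v → μ s(u, v) = 1 ∨ μ s(u, v) = 2 := fun {u v} huv =>
    hunion.subset (Or.inl huv)
  have hPS : ∀ {u v}, GPS.Adj u v → μ s(u, v) = 1 ∨ μ s(u, v) = 2 := fun {u v} huv =>
    hunion.subset (Or.inr huv)
  have hboth : ∀ {u v}, GPD.Adj u v → GPS.Adj u v → μ s(u, v) = 2 := fun {u v} h1 h2 =>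
    hinter.subset ⟨h1, h2⟩
  set N := (GNSSGraph.ofSimpleGraphs GD GS).measurements with hN
  obtain ⟨I, hIN, hI, hspan⟩ :=
    exists_linearIndepOn_span_eq (K := ℝ) (fun m : Measurement V => m.pureRow x) N
  have hpureD : ∀ u v, Measurement.pureRow ((true, false), u, v) x = distRow x u v := fun u v => by
    simp [Measurement.pureRow, Measurement.distCoeff, Measurement.biasCoeff]
  have hpureS : ∀ u v, Measurement.pureRow ((false, true), u, v) x = biasRow d u v := fun u v => by
    simp [Measurement.pureRow, Measurement.distCoeff, Measurement.biasCoeff]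
  -- the rows of the chosen pure measurements span all rows
  have hIW : Submodule.span ℝ (Set.range fun m : I => m.1.pureRow x) = rowSpan Set.univ x := by
    have h1 : Submodule.span ℝ (Set.range fun m : I => m.1.pureRow x) =
        Submodule.span ℝ ((fun m : Measurement V => m.pureRow x) '' N) := by
      rw [← hspan, Set.image_eq_range]
    rw [h1, ← isInfinitesimallyRigid_iff.1 h]
    refine le_antisymm (Submodule.span_le.2 ?_) (Submodule.span_le.2 ?_)
    · rintro _ ⟨⟨⟨s, t⟩, u, v⟩, hm, rfl⟩
      have hm' := hm
      rcases hm with ⟨-, huv⟩ | ⟨hst, huv⟩ | ⟨hst, huv⟩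
      · exact huv.elim
      · obtain ⟨rfl, rfl⟩ := Prod.ext_iff.1 hst
        change Measurement.pureRow ((true, false), u, v) x ∈ rowSpan N x
        rw [hpureD, ← row_dist]
        exact row_mem_rowSpan hm' x
      · obtain ⟨rfl, rfl⟩ := Prod.ext_iff.1 hst
        change Measurement.pureRow ((false, true), u, v) x ∈ rowSpan N x
        rw [hpureS]
        exact biasRow_mem_rowSpan hinj hm'
    · rintro _ ⟨⟨⟨s, t⟩, u, v⟩, hm, rfl⟩
      have hm' : Measurement.pureRow ((s, t), u, v) x ∈
          Submodule.span ℝ ((fun m : Measurement V => m.pureRow x) '' N) :=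
        Submodule.subset_span ⟨_, hm, rfl⟩
      rcases hm with ⟨-, huv⟩ | ⟨hst, huv⟩ | ⟨hst, huv⟩
      · exact huv.elim
      · obtain ⟨rfl, rfl⟩ := Prod.ext_iff.1 hst
        change Measurement.row ((true, false), u, v) x ∈ Submodule.span ℝ _
        rwa [row_dist, ← hpureD]
      · obtain ⟨rfl, rfl⟩ := Prod.ext_iff.1 hst
        change Measurement.row ((false, true), u, v) x ∈ Submodule.span ℝ _
        rw [row_bias, ← hpureS]
        exact Submodule.smul_mem _ _ hm'
  -- those that are not themselves linear combinations of rows of `H`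
  let mixed (m : Measurement V) : Prop := μ s(m.2.1, m.2.2) = 1 ∧
    (m.1 = (true, false) ∧ GPD.Adj m.2.1 m.2.2 ∨ m.1 = (false, true) ∧ GPS.Adj m.2.1 m.2.2)
  let edge (m : I) : Sym2 V := s(m.1.2.1, m.1.2.2)
  let M : Finset I := Finset.univ.filter fun m => mixed m.1
  -- Reversing the agents preserves the distance row and negates the bias row, so an arc `vu`
  -- supplies the combination with coefficient minus the length.
  let t (m : I) : ℝ := (if H.Γ.Arc m.1.2.1 m.1.2.2 then 1 else -1) * edgeLength x (edge m)
  have hM : ∀ {m : I}, m ∈ M → mixed m.1 := fun {m} hm => (Finset.mem_filter.1 hm).2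
  -- A single edge is not in both parts of the decomposition, so two measurements over it have the
  -- same kind and proportional rows, against independence. Distinct members of `M` thus have
  -- distinct edges, which puts the other lengths into `lengthField x (edge m)`.
  have hedge : ∀ m ∈ M, ∀ m' ∈ M, edge m = edge m' → m = m' := by
    rintro ⟨⟨st, u, v⟩, hm⟩ hmM ⟨⟨st', u', v'⟩, hm'⟩ hmM' he
    obtain ⟨hμ1, hcase⟩ := hM hmM
    obtain ⟨-, hcase'⟩ := hM hmM'
    have he' : s(u, v) = s(u', v') := he
    have hprop : ∃ c : ℝ, c ≠ 0 ∧
        c • Measurement.pureRow (st, u, v) x = (1 : ℝ) • Measurement.pureRow (st', u', v') x := by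
      rcases hcase with ⟨hst, hadj⟩ | ⟨hst, hadj⟩ <;>
        rcases hcase' with ⟨hst', hadj'⟩ | ⟨hst', hadj'⟩ <;>
        obtain rfl := hst <;> obtain rfl := hst'
      · refine ⟨1, one_ne_zero, ?_⟩
        rw [hpureD, hpureD]
        rcases Sym2.eq_iff.1 he' with ⟨rfl, rfl⟩ | ⟨rfl, rfl⟩
        · rfl
        · rw [distRow_swap]
      · exfalso
        have hadj'' : GPS.Adj u v := by
          rw [← SimpleGraph.mem_edgeSet, he']; exact hadj'
        have h2 := hboth hadj hadj''
        exact absurd (hμ1.symm.trans h2) (by norm_num)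
      · exfalso
        have hadj'' : GPD.Adj u v := by
          rw [← SimpleGraph.mem_edgeSet, he']; exact hadj'
        have h2 := hboth hadj'' hadj
        exact absurd (hμ1.symm.trans h2) (by norm_num)
      · rcases Sym2.eq_iff.1 he' with ⟨rfl, rfl⟩ | ⟨rfl, rfl⟩
        · exact ⟨1, one_ne_zero, rfl⟩
        · refine ⟨-1, by norm_num, ?_⟩
          rw [hpureS, hpureS, biasRow_swap]
          simp
    obtain ⟨c, hc, hprop⟩ := hprop
    exact LinearIndependent.eq_of_smul_apply_eq_smul_apply hI c 1 _ _ hc hprop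
  have hsign : ∀ m : I, t m = edgeLength x (edge m) ∨ t m = -edgeLength x (edge m) := fun m => by
    by_cases harc : H.Γ.Arc m.1.2.1 m.1.2.2 <;> simp [t, harc]
  have hdiag : ∀ m ∈ M, ¬ (edge m).IsDiag := by
    rintro ⟨⟨st, u, v⟩, hm⟩ hmM (huv : u = v)
    subst huv
    have h1 : H.Γ.undirected.mult s(u, u) = 1 := (hM hmM).1
    rw [H.Γ.undirected.mult_diag u] at h1
    exact zero_ne_one h1
  have hind := LinearIndependent.piecewise_add_smul (t := t) (L := fun m => lengthField x (edge m))
    (M := M) (a := fun m : I => distRow x m.1.2.1 m.1.2.2)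
    (b := fun m : I => biasRow d m.1.2.1 m.1.2.2) (c := fun m : I => m.1.pureRow x) hI
    (by
      rintro ⟨⟨st, u, v⟩, hm⟩ hmM
      rcases (hM hmM).2 with ⟨hst, -⟩ | ⟨hst, -⟩ <;> obtain rfl := hst
      · exact Or.inl (hpureD u v)
      · exact Or.inr (hpureS u v))
    (by
      intro m hm hmem
      refine hx.edgeLength_notMem_closure hd (hdiag m hm) ?_
      rcases hsign m with hs | hs
      · rwa [hs] at hmem
      · rw [hs] at hmem
        exact neg_mem_iff.1 hmem)
    (by
      intro m hm m' hm' hne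
      have hl : edgeLength x (edge m') ∈ lengthField x (edge m) :=
        Subfield.subset_closure (Or.inr ⟨edge m', fun he => hne (hedge m' hm' m hm he), rfl⟩)
      rcases hsign m' with hs | hs
      · rwa [hs]
      · rw [hs]
        exact neg_mem hl)
    (fun m _ m' c => distRow_mem_lengthField x _ _ c _)
    (fun m _ m' c => biasRow_mem_lengthField x _ _ c _)
    (fun m _ m' c => pureRow_mem_lengthField _ x c _)
  set z := M.piecewise (fun m : I => distRow x m.1.2.1 m.1.2.2 + t m • biasRow d m.1.2.1 m.1.2.2)
    (fun m : I => m.1.pureRow x) with hz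
  have hpr : ∀ {u v}, H.Γ.Arc u v →
      distRow x u v + ‖x u - x v‖ • biasRow d u v ∈ rowSpan H.measurements x := fun {u v} huv => by
    rw [← row_pseudorange]
    exact row_mem_rowSpan (Or.inl ⟨rfl, huv⟩) x
  have hpr' : ∀ {u v}, H.Γ.Arc v u →
      distRow x u v - ‖x u - x v‖ • biasRow d u v ∈ rowSpan H.measurements x := fun {u v} huv => by
    have := hpr huv
    rwa [distRow_swap, biasRow_swap, norm_sub_rev, smul_neg, ← sub_eq_add_neg] at this
  -- The two opposite arcs have rows with sum `2 D` and difference `2 ℓ B`.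
  have htwo : ∀ {u v}, μ s(u, v) = 2 → distRow x u v ∈ rowSpan H.measurements x ∧
      biasRow d u v ∈ rowSpan H.measurements x := by
    intro u v huv
    have h1 := PseudorangeGraph.arc_of_mult_eq_two huv
    have h2 : H.Γ.Arc v u := PseudorangeGraph.arc_of_mult_eq_two (by rwa [Sym2.eq_swap])
    have hne : u ≠ v := fun h => H.Γ.loopless u (by rw [← h] at h1; exact h1)
    have hl : ‖x u - x v‖ ≠ 0 := norm_ne_zero_iff.2 (sub_ne_zero.2 (hinj.ne hne))
    constructor
    · refine (Submodule.smul_mem_iff _ (two_ne_zero (α := ℝ))).1 ?_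
      have := Submodule.add_mem _ (hpr h1) (hpr' h2)
      convert this using 1
      module
    · refine (Submodule.smul_mem_iff _ (mul_ne_zero (two_ne_zero (α := ℝ)) hl)).1 ?_
      have := Submodule.sub_mem _ (hpr h1) (hpr' h2)
      convert this using 1
      module
  have hzH : ∀ m, z m ∈ rowSpan H.measurements x := by
    intro m
    by_cases hmM : m ∈ M
    · rw [hz, Finset.piecewise_eq_of_mem _ _ _ hmM]
      obtain ⟨⟨st, u, v⟩, hm⟩ := m
      have hμ1 : μ s(u, v) = 1 := (hM hmM).1
      change distRow x u v + t ⟨(st, u, v), hm⟩ • biasRow d u v ∈ _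
      by_cases harc : H.Γ.Arc u v
      · have ht : t ⟨(st, u, v), hm⟩ = ‖x u - x v‖ := by simp [t, edge, harc]
        rw [ht]
        exact hpr harc
      · have harc' := (PseudorangeGraph.arc_or_arc_of_mult_eq_one hμ1).resolve_left harc
        have ht : t ⟨(st, u, v), hm⟩ = -‖x u - x v‖ := by simp [t, edge, harc]
        rw [ht, neg_smul, ← sub_eq_add_neg]
        exact hpr' harc'
    · rw [hz, Finset.piecewise_eq_of_notMem _ _ _ hmM]
      obtain ⟨⟨⟨s, t⟩, u, v⟩, hm⟩ := m
      have hnm : ¬ mixed ((s, t), u, v) := fun h => hmM (by simp [M, h])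
      rcases hIN hm with ⟨-, huv⟩ | ⟨hst, huv⟩ | ⟨hst, huv⟩
      · exact huv.elim
      · obtain ⟨rfl, rfl⟩ := Prod.ext_iff.1 hst
        change Measurement.pureRow ((true, false), u, v) x ∈ _
        rw [hpureD]
        rcases hGD' huv with hadj | hadj
        · rw [← row_dist]
          exact row_mem_rowSpan (Or.inr (Or.inl ⟨rfl, hadj⟩)) x
        · exact (htwo ((hPD hadj).resolve_left fun h1 => hnm ⟨h1, Or.inl ⟨rfl, hadj⟩⟩)).1
      · obtain ⟨rfl, rfl⟩ := Prod.ext_iff.1 hst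
        change Measurement.pureRow ((false, true), u, v) x ∈ _
        rw [hpureS]
        rcases hGS' huv with hadj | hadj
        · exact biasRow_mem_rowSpan hinj (Or.inr (Or.inr ⟨rfl, hadj⟩))
        · exact (htwo ((hPS hadj).resolve_left fun h1 => hnm ⟨h1, Or.inr ⟨rfl, hadj⟩⟩)).2
  have hzW : ∀ m, z m ∈ Submodule.span ℝ (Set.range fun m : I => m.1.pureRow x) := fun m => by
    rw [hIW]
    exact Submodule.span_mono (Set.image_mono (Set.subset_univ _)) (hzH m)
  have hspanz := LinearIndependent.span_eq_of_mem_span hI hind hzW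
  intro k
  have hk : k.row x ∈ Submodule.span ℝ (Set.range z) := by
    rw [hspanz, hIW]
    exact row_mem_rowSpan (Set.mem_univ _) x
  refine Submodule.span_le.2 ?_ hk
  rintro _ ⟨m, rfl⟩
  exact hzH m

end InfinitesimalRigidity

/-! ### The characterization of rigidity -/

section Main

variable {V : Type*} [Fintype V] {d : ℕ}

theorem GNSSGraph.isRigidFramework_of_isDecomposition (hd : 2 ≤ d) {H : GNSSGraph V}
    {GD GS : SimpleGraph V} (hdec : H.undirected.IsDecomposition GD GS)
    (hGD : IsDistanceRigid d GD) (hGS : GS.Connected) {p : PseudorangeConfig V d}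
    (hp : PseudorangeConfig.IsGeneric p) : H.IsRigidFramework p := by
  have hp' : SpatialConfig.IsGeneric p.1 := hp
  have h1 := (isDistanceRigidFramework_iff GD p).1 (hGD p.1 hp')
  have h2 := (GNSSGraph.isRigidFramework_iff hd _ hp).1 h1
  have h3 := h2.of_connected (hp'.injective (by omega)) hGS
  exact (GNSSGraph.isRigidFramework_iff hd H hp).2 (h3.of_isDecomposition hd hp' hdec)

theorem GNSSGraph.IsRigidFramework.exists_isDecomposition [Nonempty V] (hd : 2 ≤ d)
    {H : GNSSGraph V} {p : PseudorangeConfig V d} (hp : PseudorangeConfig.IsGeneric p)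
    (h : H.IsRigidFramework p) :
    ∃ GD GS : SimpleGraph V,
      H.undirected.IsDecomposition GD GS ∧ IsDistanceRigid d GD ∧ GS.Connected := by
  have hp' : SpatialConfig.IsGeneric p.1 := hp
  have hinj := hp'.injective (by omega)
  obtain ⟨GD, GS, hdec, hrig⟩ :=
    ((GNSSGraph.isRigidFramework_iff hd H hp).1 h).exists_isDecomposition hinj
  refine ⟨GD, GS, hdec, fun y hy => ?_, hrig.connected hinj⟩
  exact (isDistanceRigidFramework_iff GD (y, 0)).2
    ((GNSSGraph.isRigidFramework_iff hd _ (p := (y, 0)) hy).2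
      (hrig.top_right.of_isGeneric hd hp' hy))

end Main

theorem theorem2 {V : Type*} [Fintype V] [Nonempty V] (d : ℕ) (hd : 2 ≤ d)
    (G : UndirectedGNSSGraph V) :
    (G.IsRigid d ∨ G.IsFlexible d) ∧
    (G.IsRigid d ↔
      ∃ GD' GS' : SimpleGraph V,
        G.IsDecomposition GD' GS' ∧ IsDistanceRigid d GD' ∧ GS'.Connected) := by
  have hflex : (∃ GD' GS' : SimpleGraph V,
      G.IsDecomposition GD' GS' ∧ IsDistanceRigid d GD' ∧ GS'.Connected) ∨ G.IsFlexible d := by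
    by_cases h : ∃ GD' GS' : SimpleGraph V,
        G.IsDecomposition GD' GS' ∧ IsDistanceRigid d GD' ∧ GS'.Connected
    · exact Or.inl h
    · refine Or.inr fun H hH p hp hrig => h ?_
      rw [← hH]
      exact hrig.exists_isDecomposition hd hp
  have hrigid : (∃ GD' GS' : SimpleGraph V,
      G.IsDecomposition GD' GS' ∧ IsDistanceRigid d GD' ∧ GS'.Connected) → G.IsRigid d := by
    rintro ⟨GD, GS, hdec, hGD, hGS⟩ H hH p hp
    rw [← hH] at hdec
    exact GNSSGraph.isRigidFramework_of_isDecomposition hd hdec hGD hGS hp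
  refine ⟨hflex.imp_left hrigid, fun h => ?_, hrigid⟩
  -- Rigidity of `G` is a universal statement; an orientation and a generic configuration ensure
  -- that it is not vacuous.
  obtain ⟨H, hH⟩ := G.exists_undirected_eq
  obtain ⟨x, hx⟩ := exists_isGeneric V d
  have hp : PseudorangeConfig.IsGeneric ((x, 0) : PseudorangeConfig V d) := hx
  rw [← hH]
  exact (h H hH _ hp).exists_isDecomposition hd hp
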